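/- \textbf{Setting.} A consumer lives for $T<\infty$ periods. In each period $t$ she privately observes her type $\theta_t\in\{l,h\}$, then an income $y_t\in Y$ is publicly drawn from $p_{\theta_t}$, where $Y\subset\mathbb R_+$ is finite and $\sum_y p_l(y)y<\sum_y p_h(y)y$. Types follow a Markov chain with initial probabilities $\pi_i>0$ and transition probabilities $\pi_{ij}$ satisfying $\pi_{hh}>\pi_{lh}$, $\pi_{ll}>\pi_{hl}$ and $\pi_{hl}>0$. A signal structure is a surjection $\phi:Y\to\Phi$ onto a finite set; write $p_i(\varphi)=\sum_{y:\phi(y)=\varphi}p_i(y)$ for $\varphi\in\Phi$. Assume $p_h(y)>0$ for every $y\in Y$ and $p_l(\varphi)>0$ for every $\varphi\in\Phi$. The consumer has utility $u(c)=2\sqrt c$, $c\ge 0$, and consumer and firm share the discount factor $\delta\in(0,1)$. A direct mechanism $M=\{z_t\}_{t=1}^T$ assigns to each history $(\phi^{t-1},\theta^{t-1})$ of past signals and reports and each current report $\theta_t$ a flow contract $z_t(\phi^{t-1},\theta^{t-1},\theta_t):Y\to\mathbb R_+$ (consumption as a function of current income). A reporting strategy chooses each report as a function of past incomes, past reports,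 past types and the current type. $M$ is incentive compatible if truth-telling maximizes the consumer's ex ante expected discounted utility over all reporting strategies. Put $v(z,\theta)=\sum_y p_\theta(y)u(z(y))$. Given $V=(V_l,V_h)$, an optimal mechanism is one maximizing the expected discounted profit $\mathbb E\sum_t\delta^{t-1}(y_t-c_t)$ (where $c_t$ is period-$t$ consumption and reports are truthful) among the incentive compatible mechanisms that give expected discounted utility $V_\theta$ to each initial type $\theta\in\{l,h\}$ under truth-telling. It is interior if all its consumption levels are strictly positive. For an optimal mechanism and $\phi^{t-1}\in\Phi^{t-1}$ let $$\nu_t(\phi^{t-1})=v(z_t(\phi^{t-1},h^{t-1},h),h),\qquad \Delta_t(\phi^{t-1})=\nu_t(\phi^{t-1})-v(z_t(\phi^{t-1},h^{t-1},h),l),$$ $$\nu^l_t(\phi^{t-1})=v(z_t(\phi^{t-1},h^{t-1},l),l),$$ where $h^{t-1}=(h,\dots,h)$: respectively the flow utility and the distortion after only high reports, and the flow utility after a first low report in period $t$. \textbf{Proposition.} If $V_h>V_l$ and $M$ is an interior optimal mechanism, then for every $1\le t\le T-1$ and every $\phi^{t-1}\in\Phi^{t-1}$: (i) $\displaystyle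 \Delta_t(\phi^{t-1})>\sum_{\varphi\in\Phi}p_h(\varphi)\,\Delta_{t+1}(\phi^{t-1},\varphi)$; (ii) $\displaystyle \sum_{\varphi\in\Phi}p_h(\varphi)\,\nu_{t+1}(\phi^{t-1},\varphi)>\nu_t(\phi^{t-1})>\sum_{\varphi\in\Phi}p_h(\varphi)\,\nu^l_{t+1}(\phi^{t-1},\varphi)$. -/

import Mathlib

open scoped NNReal

namespace DynamicInsurance

/-- The two risk types of the consumer: low `l` and high `h`. -/
inductive RiskType where
  | l
  | h
  deriving DecidableEq

instance : Fintype RiskType where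
  elems := {.l, .h}
  complete := fun θ => by cases θ <;> simp

/-- Primitives of the insurance model: a finite horizon, a discount factor, type-dependent income
distributions on the finite set `Y` of incomes, a persistent Markov chain of types, and a signal
function onto the finite set `Φ` of signals. -/
structure Environment (Y : Finset ℝ≥0) (Φ : Type*) where
  /-- number of periods -/
  T : ℕ
  /-- discount factor -/
  δ : ℝ
  δ_mem : δ ∈ Set.Ioo (0 : ℝ) 1
  /-- `p θ y` is the probability of income `y` for a consumer whose current type is `θ` -/
  p : RiskType → Y → ℝ
  p_mem : ∀ θ, p θ ∈ stdSimplex ℝ Y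
  mean_lt : ∑ y : Y, p .l y * ((y : ℝ≥0) : ℝ) < ∑ y : Y, p .h y * ((y : ℝ≥0) : ℝ)
  /-- distribution of the initial type -/
  init : RiskType → ℝ
  init_mem : init ∈ stdSimplex ℝ RiskType
  /-- `trans i j` is the probability that the next type is `j` if the current one is `i` -/
  trans : RiskType → RiskType → ℝ
  trans_mem : ∀ i, trans i ∈ stdSimplex ℝ RiskType
  persistent : ∀ i j, i ≠ j → trans j i < trans i i
  /-- the signal generated by an income realization -/
  signal : Y → Φ
  signal_surjective : Function.Surjective signal

/-- A flow contract: final consumption as a function of realized income. -/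
abbrev FlowContract (Y : Finset ℝ≥0) := Y → ℝ≥0

/-- A direct mechanism. `M η θ` is the flow contract provided after the observable history `η` of
past pairs (signal, report), listed with the most recent period first, and the current report `θ`.
In period `t` the history has length `t - 1`; values at histories of length at least `T` play
no role. -/
abbrev Mechanism (Y : Finset ℝ≥0) (Φ : Type*) :=
  List (Φ × RiskType) → RiskType → FlowContract Y

/-- A reporting strategy: the current report as a function of the private history of past triples
(income, report, true type), most recent period first, and of the current true type. -/
abbrev ReportingStrategy (Y : Finset ℝ≥0) :=
  List (Y × RiskType × RiskType) → RiskType → RiskType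

/-- Truth-telling. -/
def truthful (Y : Finset ℝ≥0) : ReportingStrategy Y := fun _ θ => θ

/-- The private history generated by the strategy `r` when the realized past pairs
(income, true type), most recent first, are as given. -/
def privateHistory {Y : Finset ℝ≥0} (r : ReportingStrategy Y) :
    List (Y × RiskType) → List (Y × RiskType × RiskType)
  | [] => []
  | (y, θ) :: past => (y, r (privateHistory r past) θ, θ) :: privateHistory r past

namespace Environment

variable {Y : Finset ℝ≥0} {Φ : Type*}

/-- Probability of the signal `s` for a consumer whose current type is `θ`. -/
def signalProb [DecidableEq Φ] (E : Environment Y Φ) (θ : RiskType) (s : Φ) : ℝ :=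
  ∑ y : Y with E.signal y = s, E.p θ y

/-- Expected utility `v(z, θ)` of a flow contract. -/
def flowUtility (E : Environment Y Φ) (u : ℝ≥0 → ℝ) (z : FlowContract Y) (θ : RiskType) : ℝ :=
  ∑ y : Y, E.p θ y * u (z y)

/-- Expected profit `ξ(z, θ)` from a flow contract. -/
def flowProfit (E : Environment Y Φ) (z : FlowContract Y) (θ : RiskType) : ℝ :=
  ∑ y : Y, E.p θ y * (((y : ℝ≥0) : ℝ) - (z y : ℝ))

/-- The expected discounted sum of the flow payoffs `g` over the next `n` periods, given the past
realizations of (income, type), most recent first, and the current type `θ`. Here `g past θ` is the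
payoff of a period with current type `θ` and past realizations `past`. -/
def discountedSum (E : Environment Y Φ) (g : List (Y × RiskType) → RiskType → ℝ) :
    ℕ → List (Y × RiskType) → RiskType → ℝ
  | 0, _, _ => 0
  | n + 1, past, θ =>
      g past θ + E.δ * ∑ y : Y, E.p θ y *
        ∑ θ' : RiskType, E.trans θ θ' * E.discountedSum g n ((y, θ) :: past) θ'

/-- The observable history (signals and reports) contained in a private history. -/
def observable (E : Environment Y Φ) (hp : List (Y × RiskType × RiskType)) :
    List (Φ × RiskType) :=
  hp.map fun x => (E.signal x.1, x.2.1)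

/-- Flow utility of the consumer with strategy `r` in the mechanism `M`, after past realizations
`past` of (income, type) and with current type `θ`. -/
def consumerFlow (E : Environment Y Φ) (u : ℝ≥0 → ℝ) (M : Mechanism Y Φ)
    (r : ReportingStrategy Y) (past : List (Y × RiskType)) (θ : RiskType) : ℝ :=
  E.flowUtility u
    (M (E.observable (privateHistory r past)) (r (privateHistory r past) θ)) θ

/-- Expected discounted utility from the strategy `r` for initial type `θ`. -/
def initialValue (E : Environment Y Φ) (u : ℝ≥0 → ℝ) (M : Mechanism Y Φ)
    (r : ReportingStrategy Y) (θ : RiskType) : ℝ :=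
  E.discountedSum (E.consumerFlow u M r) E.T [] θ

/-- Ex ante expected discounted utility from the strategy `r`. -/
def exAnteValue (E : Environment Y Φ) (u : ℝ≥0 → ℝ) (M : Mechanism Y Φ)
    (r : ReportingStrategy Y) : ℝ :=
  ∑ θ : RiskType, E.init θ * E.initialValue u M r θ

/-- Incentive compatibility: truth-telling is an optimal reporting strategy. -/
def IncentiveCompatible (E : Environment Y Φ) (u : ℝ≥0 → ℝ) (M : Mechanism Y Φ) : Prop :=
  ∀ r : ReportingStrategy Y, E.exAnteValue u M r ≤ E.exAnteValue u M (truthful Y)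

/-- Total expected discounted profit of the firm under truth-telling. -/
def profit (E : Environment Y Φ) (M : Mechanism Y Φ) : ℝ :=
  ∑ θ : RiskType, E.init θ *
    E.discountedSum
      (fun past θ => E.flowProfit (M (past.map fun x => (E.signal x.1, x.2)) θ) θ) E.T [] θ

/-- `M` is incentive compatible and delivers utility `V θ` to each initial type `θ`. -/
def Feasible (E : Environment Y Φ) (u : ℝ≥0 → ℝ) (V : RiskType → ℝ) (M : Mechanism Y Φ) : Prop :=
  E.IncentiveCompatible u M ∧ ∀ θ, E.initialValue u M (truthful Y) θ = V θ

/-- `M` maximizes profit among the incentive compatible mechanisms that deliver the utilities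
`V`. -/
def IsOptimal (E : Environment Y Φ) (u : ℝ≥0 → ℝ) (V : RiskType → ℝ) (M : Mechanism Y Φ) : Prop :=
  E.Feasible u V M ∧ ∀ M' : Mechanism Y Φ, E.Feasible u V M' → E.profit M' ≤ E.profit M

/-- All consumption flows are strictly positive. -/
def Interior (E : Environment Y Φ) (M : Mechanism Y Φ) : Prop :=
  ∀ (η : List (Φ × RiskType)) (θ : RiskType) (y : Y), η.length < E.T → 0 < M η θ y

/-- The observable history with the given signals (most recent first) and only high reports. -/
def highHistory (sig : List Φ) : List (Φ × RiskType) := sig.map fun s => (s, RiskType.h)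

/-- `ν_t(φ^{t-1})`: flow utility of a high type after high reports in periods `1, …, t`. -/
def highFlow (E : Environment Y Φ) (u : ℝ≥0 → ℝ) (M : Mechanism Y Φ) (sig : List Φ) : ℝ :=
  E.flowUtility u (M (highHistory sig) .h) .h

/-- `Δ_t(φ^{t-1})`: the distortion, i.e. the utility wedge between the two types in the flow
contract provided after high reports in periods `1, …, t`. -/
def distortion (E : Environment Y Φ) (u : ℝ≥0 → ℝ) (M : Mechanism Y Φ) (sig : List Φ) : ℝ :=
  E.highFlow u M sig - E.flowUtility u (M (highHistory sig) .h) .l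

/-- `ν^l_t(φ^{t-1})`: flow utility of a low type whose first low report is in period `t`. -/
def lowFlow (E : Environment Y Φ) (u : ℝ≥0 → ℝ) (M : Mechanism Y Φ) (sig : List Φ) : ℝ :=
  E.flowUtility u (M (highHistory sig) .l) .l

end Environment

/-- The utility function `u(c) = 2√c`. -/
noncomputable def sqrtUtility (c : ℝ≥0) : ℝ := 2 * Real.sqrt (c : ℝ)

end DynamicInsurance

namespace DynamicInsurance

/-! With `u(c) = 2√c`, providing utility `u` costs `u²/4`. In terms of utilities the firm therefore
minimizes a quadratic form under linear constraints (`profit_eq`), and a guessed solution can be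
verified by a projection argument.

The guess is `candidate`. A first low report settles utility at a constant forever. After high
reports only, utility is `L + m (1 - p_l(y)/p_h(y))`, where `m` acts as the multiplier of the low
type's incentive constraint. With `n` periods left, write `A` for `annuity n`, `g` for `gapCoeff n`,
and `q = g / A`. The promised values are `L A` to the high type and `L A - g m` to the low type, so
the settled level is `L - q m`. When a signal with likelihood ratio `r` arrives, `m` becomes `m' = d
r m` and `L` becomes `L + m (1 - r) + π_hl q m'`, with `q` and `d` taken at the number of periods
then left. The recursion for `g` makes the low type indifferent between the two reports
(`reportValue_candidate_h`). The value of `d` makes the first-order condition hold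
(`le_historySum_inner`).

Let `C` be the candidate, `U` the utilities of an interior optimum and `X = U - C`. The first-order
condition gives `⟨C, X⟩ ≥ 0`. For small `ε` the mixture `C + (1 - ε) X` is nonnegative, hence a
feasible mechanism, and it may not cost less than `U = C + X`. This forces `⟨X, X⟩ = 0`, so `U = C`
wherever the probability is positive (`utilityPlan_eq_candidate`).

It remains to read off the flows: `ν = L`, `Δ = m (R - 1)` with `R > 1`, and `ν^l = L - q m`. Since
`r` has mean one under `p_h`, the expected next values of `m`, `ν` and `ν^l` are `d m`, `L + π_hl q
d m` and `L - π_hh q d m`. The claims follow from `0 < d < 1`, `q > 0`, `m > 0`. -/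

lemma sum_riskType (f : RiskType → ℝ) : ∑ θ, f θ = f .l + f .h := by
  change Finset.sum {RiskType.l, RiskType.h} f = _
  rw [Finset.sum_pair (by decide)]

/-- A mechanism described by the utility levels it provides. -/
abbrev UtilityPlan (Y : Finset ℝ≥0) (Φ : Type*) := List (Φ × RiskType) → RiskType → Y → ℝ

namespace Environment

variable {Y : Finset ℝ≥0} {Φ : Type*}

/-! ### Elementary facts on the primitives. -/

section Primitives

variable (E : Environment Y Φ)

lemma δ_pos : 0 < E.δ := E.δ_mem.1

lemma p_nonneg (θ : RiskType) (y : Y) : 0 ≤ E.p θ y := (E.p_mem θ).1 y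

lemma sum_p (θ : RiskType) : ∑ y, E.p θ y = 1 := (E.p_mem θ).2

lemma trans_nonneg (i j : RiskType) : 0 ≤ E.trans i j := (E.trans_mem i).1 j

lemma trans_l_add (i : RiskType) : E.trans i .l + E.trans i .h = 1 := by
  rw [← sum_riskType]; exact (E.trans_mem i).2

lemma trans_hh_pos : 0 < E.trans .h .h :=
  (E.trans_nonneg .l .h).trans_lt (E.persistent .h .l (by decide))

lemma sum_p_mul_const (θ : RiskType) (c : ℝ) : ∑ y, E.p θ y * c = c := by
  rw [← Finset.sum_mul, E.sum_p, one_mul]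

end Primitives

/-! ### Expected discounted sums over observable histories. -/

section HistorySum

variable (E : Environment Y Φ)

/-- The signals and types contained in past realizations. -/
def signals (past : List (Y × RiskType)) : List (Φ × RiskType) :=
  past.map fun x => (E.signal x.1, x.2)

/-- Expected discounted sum, under truthful reports, of a payoff `G` that depends on the observable
history and on the current type. -/
def historySum (G : List (Φ × RiskType) → RiskType → ℝ) :
    ℕ → List (Φ × RiskType) → RiskType → ℝ
  | 0, _, _ => 0
  | n + 1, η, θ =>
      G η θ + E.δ * ∑ y : Y, E.p θ y *
        ∑ θ' : RiskType, E.trans θ θ' * historySum G n ((E.signal y, θ) :: η) θ'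

lemma discountedSum_signals (G : List (Φ × RiskType) → RiskType → ℝ) (n : ℕ)
    (past : List (Y × RiskType)) (θ : RiskType) :
    E.discountedSum (fun past θ => G (E.signals past) θ) n past θ
      = E.historySum G n (E.signals past) θ := by
  induction n generalizing past θ with
  | zero => rfl
  | succ n ih => simp only [discountedSum, historySum, ih]; rfl

lemma discountedSum_linear (a b : ℝ) (f g : List (Y × RiskType) → RiskType → ℝ) (n : ℕ)
    (past : List (Y × RiskType)) (θ : RiskType) :
    E.discountedSum (fun past θ => a * f past θ + b * g past θ) n past θ
      = a * E.discountedSum f n past θ + b * E.discountedSum g n past θ := by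
  induction n generalizing past θ with
  | zero => simp [discountedSum]
  | succ n ih =>
    have : ∑ y : Y, E.p θ y * ∑ θ' : RiskType, E.trans θ θ' *
        E.discountedSum (fun past θ => a * f past θ + b * g past θ) n ((y, θ) :: past) θ'
        = a * (∑ y : Y, E.p θ y * ∑ θ' : RiskType, E.trans θ θ' *
            E.discountedSum f n ((y, θ) :: past) θ')
          + b * (∑ y : Y, E.p θ y * ∑ θ' : RiskType, E.trans θ θ' *
            E.discountedSum g n ((y, θ) :: past) θ') := by
      rw [Finset.mul_sum, Finset.mul_sum, ← Finset.sum_add_distrib]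
      refine Finset.sum_congr rfl fun y _ => ?_
      simp only [ih, sum_riskType]
      ring
    simp only [discountedSum, this]
    ring

lemma historySum_linear (a b : ℝ) (F G : List (Φ × RiskType) → RiskType → ℝ) (n : ℕ)
    (η : List (Φ × RiskType)) (θ : RiskType) :
    E.historySum (fun η θ => a * F η θ + b * G η θ) n η θ
      = a * E.historySum F n η θ + b * E.historySum G n η θ := by
  induction n generalizing η θ with
  | zero => simp [historySum]
  | succ n ih =>
    have : ∑ y : Y, E.p θ y * ∑ θ' : RiskType, E.trans θ θ' *
        E.historySum (fun η θ => a * F η θ + b * G η θ) n ((E.signal y, θ) :: η) θ'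
        = a * (∑ y : Y, E.p θ y * ∑ θ' : RiskType, E.trans θ θ' *
            E.historySum F n ((E.signal y, θ) :: η) θ')
          + b * (∑ y : Y, E.p θ y * ∑ θ' : RiskType, E.trans θ θ' *
            E.historySum G n ((E.signal y, θ) :: η) θ') := by
      rw [Finset.mul_sum, Finset.mul_sum, ← Finset.sum_add_distrib]
      refine Finset.sum_congr rfl fun y _ => ?_
      simp only [ih, sum_riskType]
      ring
    simp only [historySum, this]
    ring

variable {E} in
lemma historySum_nonneg {G : List (Φ × RiskType) → RiskType → ℝ} (hG : ∀ η θ, 0 ≤ G η θ) (n : ℕ)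
    (η : List (Φ × RiskType)) (θ : RiskType) : 0 ≤ E.historySum G n η θ := by
  induction n generalizing η θ with
  | zero => exact le_rfl
  | succ n ih =>
    exact add_nonneg (hG _ _) (mul_nonneg E.δ_pos.le (Finset.sum_nonneg fun y _ =>
      mul_nonneg (E.p_nonneg _ _) (Finset.sum_nonneg fun θ' _ =>
        mul_nonneg (E.trans_nonneg _ _) (ih _ _))))

-- A sum of nonnegative terms vanishes only if each term does, so a zero value propagates to every
-- successor reached with positive probability.
variable {E} in
lemma historySum_succ_eq_zero {G : List (Φ × RiskType) → RiskType → ℝ} (hG : ∀ η θ, 0 ≤ G η θ)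
    {n : ℕ} {η : List (Φ × RiskType)} {θ : RiskType} (h : E.historySum G (n + 1) η θ = 0) :
    G η θ = 0 ∧ ∀ y θ', 0 < E.p θ y → 0 < E.trans θ θ' →
      E.historySum G n ((E.signal y, θ) :: η) θ' = 0 := by
  have hin : ∀ y θ', 0 ≤ E.trans θ θ' * E.historySum G n ((E.signal y, θ) :: η) θ' := fun y θ' =>
    mul_nonneg (E.trans_nonneg _ _) (historySum_nonneg hG _ _ _)
  have hout : ∀ y, 0 ≤ E.p θ y *
      ∑ θ', E.trans θ θ' * E.historySum G n ((E.signal y, θ) :: η) θ' := fun y =>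
    mul_nonneg (E.p_nonneg _ _) (Finset.sum_nonneg fun θ' _ => hin y θ')
  have hsum := Finset.sum_nonneg (s := Finset.univ) fun y _ => hout y
  rw [historySum, add_eq_zero_iff_of_nonneg (hG _ _) (mul_nonneg E.δ_pos.le hsum)] at h
  refine ⟨h.1, fun y θ' hy hθ' => ?_⟩
  have h2 := (mul_eq_zero.1 h.2).resolve_left E.δ_pos.ne'
  have h3 := (Finset.sum_eq_zero_iff_of_nonneg fun y _ => hout y).1 h2 y (Finset.mem_univ _)
  have h4 := (mul_eq_zero.1 h3).resolve_left hy.ne'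
  have h5 := (Finset.sum_eq_zero_iff_of_nonneg fun θ' _ => hin y θ').1 h4 θ' (Finset.mem_univ _)
  exact (mul_eq_zero.1 h5).resolve_left hθ'.ne'

/-- Ex ante expected discounted sum of a payoff under truthful reports. -/
def total (G : List (Φ × RiskType) → RiskType → ℝ) : ℝ :=
  ∑ θ : RiskType, E.init θ * E.historySum G E.T [] θ

lemma total_linear (a b : ℝ) (F G : List (Φ × RiskType) → RiskType → ℝ) :
    E.total (fun η θ => a * F η θ + b * G η θ) = a * E.total F + b * E.total G := by
  simp only [total, historySum_linear, sum_riskType]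
  ring

variable {E} in
/-- A nonnegative payoff with zero expected sum vanishes after every history of high reports. -/
lemma eq_zero_of_total_eq_zero (hinit : ∀ θ, 0 < E.init θ) (hhl : 0 < E.trans .h .l)
    (hph : ∀ y, 0 < E.p .h y) {G : List (Φ × RiskType) → RiskType → ℝ} (hG : ∀ η θ, 0 ≤ G η θ)
    (h : E.total G = 0) {n : ℕ} {sig : List Φ} (hsig : n + 1 + sig.length = E.T) (θ : RiskType) :
    G (highHistory sig) θ = 0 := by
  -- The zero is carried forward along the path of high reports. Each such history has positive
  -- probability, and so does either type after it, because `π_hl` and `π_hh` are positive.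
  suffices H : ∀ (sig : List Φ) (n : ℕ), n + sig.length = E.T →
      ∀ θ, E.historySum G n (highHistory sig) θ = 0 from
    (historySum_succ_eq_zero hG (H sig (n + 1) hsig θ)).1
  clear hsig
  intro sig
  induction sig with
  | nil =>
    rintro n hn θ
    obtain rfl : n = E.T := by simpa using hn
    have h1 := (Finset.sum_eq_zero_iff_of_nonneg fun θ _ =>
      mul_nonneg (hinit θ).le (historySum_nonneg hG _ _ _)).1 h θ (Finset.mem_univ _)
    exact (mul_eq_zero.1 h1).resolve_left (hinit θ).ne'
  | cons s sig ih =>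
    intro n hn θ
    have h1 := ih (n + 1) (by rw [List.length_cons] at hn; omega) .h
    obtain ⟨y, rfl⟩ := E.signal_surjective s
    refine (historySum_succ_eq_zero hG h1).2 y θ (hph y) ?_
    cases θ
    exacts [hhl, E.trans_hh_pos]

end HistorySum

/-! ### Values of reports and strategies as linear functions of utility plans. -/

section Plans

variable (E : Environment Y Φ)

/-- Expected utility in the current period under truthful reports. -/
def planUtility (U : UtilityPlan Y Φ) (η : List (Φ × RiskType)) (θ : RiskType) : ℝ :=
  ∑ y : Y, E.p θ y * U η θ y

/-- Truthful continuation value. -/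
def truthValue (U : UtilityPlan Y Φ) : ℕ → List (Φ × RiskType) → RiskType → ℝ :=
  E.historySum (E.planUtility U)

/-- Value of a consumer of type `θ` who now reports `θr`, if `W` gives the continuation values. -/
def reportValue (U : UtilityPlan Y Φ) (W : List (Φ × RiskType) → RiskType → ℝ)
    (η : List (Φ × RiskType)) (θ θr : RiskType) : ℝ :=
  ∑ y : Y, E.p θ y * U η θr y + E.δ * ∑ y : Y, E.p θ y *
    ∑ θ' : RiskType, E.trans θ θ' * W ((E.signal y, θr) :: η) θ'

/-- Flow utility from the strategy `r` in a utility plan. -/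
def strategyFlow (U : UtilityPlan Y Φ) (r : ReportingStrategy Y)
    (past : List (Y × RiskType)) (θ : RiskType) : ℝ :=
  ∑ y : Y, E.p θ y * U (E.observable (privateHistory r past)) (r (privateHistory r past) θ) y

/-- Ex ante value of the strategy `r` in a utility plan. -/
def strategyValue (U : UtilityPlan Y Φ) (r : ReportingStrategy Y) : ℝ :=
  ∑ θ : RiskType, E.init θ * E.discountedSum (E.strategyFlow U r) E.T [] θ

lemma truthValue_succ (U : UtilityPlan Y Φ) (n : ℕ) (η : List (Φ × RiskType)) (θ : RiskType) :
    E.truthValue U (n + 1) η θ = E.reportValue U (E.truthValue U n) η θ θ := rfl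

lemma discountedSum_strategyFlow_succ (U : UtilityPlan Y Φ) (r : ReportingStrategy Y) (n : ℕ)
    (past : List (Y × RiskType)) (θ : RiskType) :
    E.discountedSum (E.strategyFlow U r) (n + 1) past θ
      = ∑ y : Y, E.p θ y * U (E.observable (privateHistory r past))
          (r (privateHistory r past) θ) y
        + E.δ * ∑ y : Y, E.p θ y * ∑ θ' : RiskType, E.trans θ θ' *
          E.discountedSum (E.strategyFlow U r) n ((y, θ) :: past) θ' := rfl

lemma observable_cons (r : ReportingStrategy Y) (past : List (Y × RiskType)) (y : Y)
    (θ : RiskType) :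
    E.observable (privateHistory r ((y, θ) :: past))
      = (E.signal y, r (privateHistory r past) θ) :: E.observable (privateHistory r past) := rfl

lemma length_observable (r : ReportingStrategy Y) (past : List (Y × RiskType)) :
    (E.observable (privateHistory r past)).length = past.length := by
  induction past with
  | nil => rfl
  | cons x past ih => obtain ⟨y, θ⟩ := x; rw [observable_cons, List.length_cons, ih]; rfl

/-- A strategy that is truthful from some period on earns the truthful continuation value. -/
lemma discountedSum_eq_truthValue (U : UtilityPlan Y Φ) (r : ReportingStrategy Y) (k : ℕ)
    (hr : ∀ past : List (Y × RiskType), k ≤ past.length →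
      ∀ θ, r (privateHistory r past) θ = θ)
    (n : ℕ) (past : List (Y × RiskType)) (hk : k ≤ past.length) (θ : RiskType) :
    E.discountedSum (E.strategyFlow U r) n past θ
      = E.truthValue U n (E.observable (privateHistory r past)) θ := by
  induction n generalizing past θ with
  | zero => rfl
  | succ n ih =>
    rw [discountedSum_strategyFlow_succ, truthValue_succ, reportValue, hr past hk]
    have : ∀ y θ', E.discountedSum (E.strategyFlow U r) n ((y, θ) :: past) θ'
        = E.truthValue U n ((E.signal y, θ) :: E.observable (privateHistory r past)) θ' := by
      intro y θ'
      rw [ih _ (hk.trans (by simp)), observable_cons, hr past hk]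
    simp only [this]

lemma strategyValue_truthful (U : UtilityPlan Y Φ) :
    E.strategyValue U (truthful Y) = ∑ θ, E.init θ * E.truthValue U E.T [] θ := by
  unfold strategyValue
  refine Finset.sum_congr rfl fun θ _ => ?_
  rw [E.discountedSum_eq_truthValue U (truthful Y) 0 (fun _ _ _ => rfl) _ _ le_rfl]
  rfl

lemma strategyValue_linear (a b : ℝ) (U U' : UtilityPlan Y Φ) (r : ReportingStrategy Y) :
    E.strategyValue (fun η θ y => a * U η θ y + b * U' η θ y) r
      = a * E.strategyValue U r + b * E.strategyValue U' r := by
  have : E.strategyFlow (fun η θ y => a * U η θ y + b * U' η θ y) r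
      = fun past θ => a * E.strategyFlow U r past θ + b * E.strategyFlow U' r past θ := by
    funext past θ
    simp only [strategyFlow]
    rw [Finset.mul_sum, Finset.mul_sum, ← Finset.sum_add_distrib]
    exact Finset.sum_congr rfl fun y _ => by ring
  simp only [strategyValue, this, discountedSum_linear, sum_riskType]
  ring

lemma truthValue_linear (a b : ℝ) (U U' : UtilityPlan Y Φ) (n : ℕ) (η : List (Φ × RiskType))
    (θ : RiskType) :
    E.truthValue (fun η θ y => a * U η θ y + b * U' η θ y) n η θ
      = a * E.truthValue U n η θ + b * E.truthValue U' n η θ := by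
  have : E.planUtility (fun η θ y => a * U η θ y + b * U' η θ y)
      = fun η θ => a * E.planUtility U η θ + b * E.planUtility U' η θ := by
    funext η θ
    simp only [planUtility]
    rw [Finset.mul_sum, Finset.mul_sum, ← Finset.sum_add_distrib]
    exact Finset.sum_congr rfl fun y _ => by ring
  simp only [truthValue, this, historySum_linear]

lemma reportValue_linear (a b : ℝ) (U U' : UtilityPlan Y Φ)
    (W W' : List (Φ × RiskType) → RiskType → ℝ) (η : List (Φ × RiskType)) (θ θr : RiskType) :
    E.reportValue (fun η θ y => a * U η θ y + b * U' η θ y)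
        (fun η θ => a * W η θ + b * W' η θ) η θ θr
      = a * E.reportValue U W η θ θr + b * E.reportValue U' W' η θ θr := by
  have h1 : ∑ y : Y, E.p θ y * (a * U η θr y + b * U' η θr y)
      = a * ∑ y : Y, E.p θ y * U η θr y + b * ∑ y : Y, E.p θ y * U' η θr y := by
    rw [Finset.mul_sum, Finset.mul_sum, ← Finset.sum_add_distrib]
    exact Finset.sum_congr rfl fun y _ => by ring
  have h2 : ∑ y : Y, E.p θ y * ∑ θ' : RiskType, E.trans θ θ' *
        (a * W ((E.signal y, θr) :: η) θ' + b * W' ((E.signal y, θr) :: η) θ')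
      = a * (∑ y : Y, E.p θ y * ∑ θ' : RiskType, E.trans θ θ' * W ((E.signal y, θr) :: η) θ')
        + b * ∑ y : Y, E.p θ y * ∑ θ' : RiskType, E.trans θ θ' *
            W' ((E.signal y, θr) :: η) θ' := by
    rw [Finset.mul_sum, Finset.mul_sum, ← Finset.sum_add_distrib]
    refine Finset.sum_congr rfl fun y _ => ?_
    simp only [sum_riskType]
    ring
  simp only [reportValue, h1, h2]
  ring

/-- Inner product of two utility plans in the current period. -/
def planInner (U U' : UtilityPlan Y Φ) (η : List (Φ × RiskType)) (θ : RiskType) : ℝ :=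
  ∑ y : Y, E.p θ y * (U η θ y * U' η θ y)

end Plans

/-! ### From ex ante incentive compatibility to one-shot constraints. -/

section Deviation

variable (E : Environment Y Φ)

open Classical in
/-- The strategy that misreports a low type once, after the observable history `η₀`. -/
noncomputable def deviation (η₀ : List (Φ × RiskType)) : ReportingStrategy Y :=
  fun hp θ => if E.observable hp = η₀ then .h else θ

lemma deviation_of_length_ne {η₀ : List (Φ × RiskType)} {past : List (Y × RiskType)}
    (h : past.length ≠ η₀.length) (θ : RiskType) :
    E.deviation η₀ (privateHistory (E.deviation η₀) past) θ = θ := by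
  rw [deviation, if_neg]
  intro h'
  exact h (by rw [← h', length_observable])

lemma observable_deviation {η₀ : List (Φ × RiskType)} {past : List (Y × RiskType)}
    (h : past.length ≤ η₀.length) :
    E.observable (privateHistory (E.deviation η₀) past) = E.signals past := by
  induction past with
  | nil => rfl
  | cons x past ih =>
    obtain ⟨y, θ⟩ := x
    rw [List.length_cons] at h
    rw [observable_cons, ih (by omega), E.deviation_of_length_ne (by omega)]
    rfl

open Classical in
/-- Indicator of a low type after the observable history `η₀`. -/
noncomputable def lowAt (η₀ η : List (Φ × RiskType)) (θ : RiskType) : ℝ :=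
  if η = η₀ ∧ θ = .l then 1 else 0

lemma historySum_lowAt_of_length_lt {η₀ η : List (Φ × RiskType)} (h : η₀.length < η.length)
    (n : ℕ) (θ : RiskType) : E.historySum (lowAt η₀) n η θ = 0 := by
  induction n generalizing η θ with
  | zero => rfl
  | succ n ih =>
    have h1 : lowAt η₀ η θ = 0 := if_neg fun h' => by rw [h'.1] at h; exact lt_irrefl _ h
    have h2 : ∀ y θ', E.historySum (lowAt η₀) n ((E.signal y, θ) :: η) θ' = 0 := fun y θ' =>
      ih (h.trans (by simp)) θ'
    simp [historySum, h1, h2]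

/-- The deviation differs from truth-telling only for a low type at `η₀`. Its total gain is thus the
one-shot gain there times the discounted probability of reaching that event. -/
lemma discountedSum_deviation (U : UtilityPlan Y Φ) (η₀ : List (Φ × RiskType)) (m : ℕ)
    (hm : m + 1 + η₀.length = E.T) (n : ℕ) (past : List (Y × RiskType)) (hn : n + past.length = E.T)
    (hle : past.length ≤ η₀.length) (θ : RiskType) :
    E.discountedSum (E.strategyFlow U (E.deviation η₀)) n past θ
      = E.truthValue U n (E.signals past) θ
        + (E.reportValue U (E.truthValue U m) η₀ .l .h - E.truthValue U (m + 1) η₀ .l)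
          * E.historySum (lowAt η₀) n (E.signals past) θ := by
  set c := E.reportValue U (E.truthValue U m) η₀ .l .h - E.truthValue U (m + 1) η₀ .l with hc
  induction n generalizing past θ with
  | zero => simp [discountedSum, truthValue, historySum]
  | succ n ih =>
    rcases hle.lt_or_eq with hlt | heq
    · rw [discountedSum_strategyFlow_succ, truthValue_succ, reportValue, historySum,
        E.deviation_of_length_ne hlt.ne, E.observable_deviation hle]
      have h0 : lowAt η₀ (E.signals past) θ = 0 := by
        refine if_neg fun h' => ?_
        have := congrArg List.length h'.1
        simp [signals] at this
        omega
      have h1 : ∀ y θ', E.discountedSum (E.strategyFlow U (E.deviation η₀)) n ((y, θ) :: past) θ'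
          = E.truthValue U n ((E.signal y, θ) :: E.signals past) θ'
            + c * E.historySum (lowAt η₀) n ((E.signal y, θ) :: E.signals past) θ' :=
        fun y θ' => ih ((y, θ) :: past) (by simp; omega) (by simpa using hlt) θ'
      have h2 : ∑ y : Y, E.p θ y * ∑ θ' : RiskType, E.trans θ θ' *
            E.discountedSum (E.strategyFlow U (E.deviation η₀)) n ((y, θ) :: past) θ'
          = ∑ y : Y, E.p θ y * ∑ θ' : RiskType, E.trans θ θ' *
              E.truthValue U n ((E.signal y, θ) :: E.signals past) θ'
            + c * ∑ y : Y, E.p θ y * ∑ θ' : RiskType, E.trans θ θ' *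
              E.historySum (lowAt η₀) n ((E.signal y, θ) :: E.signals past) θ' := by
        rw [Finset.mul_sum, ← Finset.sum_add_distrib]
        refine Finset.sum_congr rfl fun y _ => ?_
        simp only [h1, sum_riskType]
        ring
      rw [h0, h2]
      ring
    -- At the date of the possible misreport the continuation is truthful, and the event counted by
    -- `lowAt` cannot recur later.
    · obtain rfl : n = m := by omega
      have hobs := E.observable_deviation hle
      have hafter : ∀ y θ', E.discountedSum (E.strategyFlow U (E.deviation η₀)) n
          ((y, θ) :: past) θ' = E.truthValue U n ((E.signal y,
            E.deviation η₀ (privateHistory (E.deviation η₀) past) θ) :: E.signals past) θ' := by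
        intro y θ'
        rw [E.discountedSum_eq_truthValue U _ (η₀.length + 1)
          (fun past h θ => E.deviation_of_length_ne (by omega) θ) _ _ (by simp [heq]),
          observable_cons, hobs]
      have hzero : ∀ y θ', E.historySum (lowAt η₀) n ((E.signal y, θ) :: E.signals past) θ' = 0 :=
        fun y θ' => E.historySum_lowAt_of_length_lt (by simp [signals, heq]) n θ'
      rw [discountedSum_strategyFlow_succ, hobs, historySum]
      simp only [hafter, hzero, mul_zero, Finset.sum_const_zero, add_zero]
      by_cases hη : E.signals past = η₀
      · have hdev : E.deviation η₀ (privateHistory (E.deviation η₀) past) θ = .h :=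
          if_pos (hobs.trans hη)
        rw [hdev, hη]
        cases θ
        · have : lowAt η₀ η₀ .l = 1 := if_pos ⟨rfl, rfl⟩
          rw [this, hc, reportValue]
          ring
        · have : lowAt η₀ η₀ .h = 0 := if_neg (by simp)
          rw [this, mul_zero, add_zero]
          rfl
      · have hdev : E.deviation η₀ (privateHistory (E.deviation η₀) past) θ = θ :=
          if_neg (by rwa [hobs])
        have : lowAt η₀ (E.signals past) θ = 0 := if_neg fun h => hη h.1
        rw [hdev, this, mul_zero, add_zero]
        rfl

variable {E} in
/-- Ex ante incentive compatibility implies that after high reports a low type does not gain from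
one high report followed by truth-telling. -/
lemma reportValue_le_truthValue (hinit : ∀ θ, 0 < E.init θ) (hhl : 0 < E.trans .h .l)
    (hph : ∀ y, 0 < E.p .h y) {U : UtilityPlan Y Φ}
    (hU : ∀ r, E.strategyValue U r ≤ E.strategyValue U (truthful Y)) (n : ℕ) (sig : List Φ)
    (hn : n + 1 + sig.length = E.T) :
    E.reportValue U (E.truthValue U n) (highHistory sig) .l .h
      ≤ E.truthValue U (n + 1) (highHistory sig) .l := by
  have hlen : (highHistory sig).length = sig.length := by simp [highHistory]
  have hnn : ∀ η θ, 0 ≤ lowAt (highHistory sig) η θ := fun η θ => by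
    unfold lowAt; split_ifs <;> norm_num
  -- The event of a low type after these high reports has positive probability, so the sign of the
  -- one-shot gain can be recovered by division.
  have hne : E.total (lowAt (highHistory sig)) ≠ 0 := fun h0 => by
    have := eq_zero_of_total_eq_zero hinit hhl hph hnn h0 hn .l
    rw [lowAt, if_pos ⟨rfl, rfl⟩] at this
    exact one_ne_zero this
  have hpos : 0 < E.total (lowAt (highHistory sig)) :=
    lt_of_le_of_ne (Finset.sum_nonneg fun θ _ =>
      mul_nonneg (hinit θ).le (historySum_nonneg hnn _ _ _)) hne.symm
  have h1 := hU (E.deviation (highHistory sig))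
  rw [strategyValue_truthful, strategyValue] at h1
  simp only [E.discountedSum_deviation U _ n (by rw [hlen]; exact hn) E.T [] rfl
    (Nat.zero_le _)] at h1
  have h2 : (E.reportValue U (E.truthValue U n) (highHistory sig) .l .h
      - E.truthValue U (n + 1) (highHistory sig) .l) * E.total (lowAt (highHistory sig)) ≤ 0 := by
    simp only [total, sum_riskType] at h1 ⊢
    simp only [signals, List.map_nil] at h1
    linarith
  exact sub_nonpos.1 (nonpos_of_mul_nonpos_left h2 hpos)

end Deviation

/-! ### Income likelihood ratios, annuities and persistence. -/

section LikelihoodRatios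

variable (E : Environment Y Φ)

/-- Likelihood ratio of an income. -/
noncomputable def incomeRatio (y : Y) : ℝ := E.p .l y / E.p .h y

variable {E} in
lemma p_l_eq (hph : ∀ y, 0 < E.p .h y) (y : Y) : E.p .l y = E.p .h y * E.incomeRatio y := by
  rw [incomeRatio, mul_div_cancel₀ _ (hph y).ne']

/-- Expected likelihood ratio of the income of a low type. -/
noncomputable def meanIncomeRatio : ℝ := ∑ y, E.p .l y * E.incomeRatio y

variable {E} in
lemma sum_p_h_incomeRatio (hph : ∀ y, 0 < E.p .h y) : ∑ y, E.p .h y * E.incomeRatio y = 1 := by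
  rw [← E.sum_p .l]
  exact Finset.sum_congr rfl fun y _ => (p_l_eq hph y).symm

-- `R - 1` is the variance of the likelihood ratio under `p_h`. It is positive because equal
-- distributions would have equal means.
variable {E} in
lemma one_lt_meanIncomeRatio (hph : ∀ y, 0 < E.p .h y) : 1 < E.meanIncomeRatio := by
  have h1 : ∑ y, E.p .h y * (1 - E.incomeRatio y) ^ 2 = E.meanIncomeRatio - 1 := by
    have : ∀ y, E.p .h y * (1 - E.incomeRatio y) ^ 2
        = E.p .h y - 2 * (E.p .h y * E.incomeRatio y) + E.p .l y * E.incomeRatio y := fun y => by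
      rw [p_l_eq hph]; ring
    simp only [this, Finset.sum_add_distrib, Finset.sum_sub_distrib, ← Finset.mul_sum, E.sum_p,
      sum_p_h_incomeRatio hph, meanIncomeRatio]
    ring
  have hnn : ∀ y ∈ Finset.univ, 0 ≤ E.p .h y * (1 - E.incomeRatio y) ^ 2 := fun y _ =>
    mul_nonneg (hph y).le (sq_nonneg _)
  have h2 := Finset.sum_nonneg hnn
  have h3 : ∑ y, E.p .h y * (1 - E.incomeRatio y) ^ 2 ≠ 0 := fun h0 => by
    have hp : ∀ y, E.p .l y = E.p .h y := fun y => by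
      have := (mul_eq_zero.1 ((Finset.sum_eq_zero_iff_of_nonneg hnn).1 h0 y
        (Finset.mem_univ _))).resolve_left (hph y).ne'
      rw [p_l_eq hph, ← sub_eq_zero.1 (pow_eq_zero_iff two_ne_zero |>.1 this), mul_one]
    have := E.mean_lt
    simp only [hp] at this
    exact lt_irrefl _ this
  have := lt_of_le_of_ne h2 h3.symm
  linarith

/-- Present value of one unit in each of `n` periods. -/
def annuity : ℕ → ℝ
  | 0 => 0
  | n + 1 => 1 + E.δ * annuity n

/-- Persistence of the type process. -/
def persistence : ℝ := E.trans .h .h - E.trans .l .h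

lemma annuity_nonneg (n : ℕ) : 0 ≤ E.annuity n := by
  induction n with
  | zero => exact le_rfl
  | succ n ih => exact add_nonneg zero_le_one (mul_nonneg E.δ_pos.le ih)

lemma annuity_succ_pos (n : ℕ) : 0 < E.annuity (n + 1) :=
  add_pos_of_pos_of_nonneg one_pos (mul_nonneg E.δ_pos.le (E.annuity_nonneg n))

lemma persistence_pos : 0 < E.persistence := sub_pos.2 (E.persistent .h .l (by decide))

lemma persistence_eq : E.persistence = E.trans .l .l - E.trans .h .l := by
  have h1 := E.trans_l_add .l
  have h2 := E.trans_l_add .h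
  unfold persistence
  linarith

/-- Decay of the multiplier if the distortion cost per unit of annuity is `q`. -/
noncomputable def decayRate (q : ℝ) : ℝ :=
  E.persistence / (E.trans .h .h * (1 + E.trans .h .l * q))

lemma decayRate_pos {q : ℝ} (hq : 0 ≤ q) : 0 < E.decayRate q :=
  div_pos E.persistence_pos (mul_pos E.trans_hh_pos
    (add_pos_of_pos_of_nonneg one_pos (mul_nonneg (E.trans_nonneg _ _) hq)))

variable {E} in
lemma reportValue_of_const {U : UtilityPlan Y Φ} {W : List (Φ × RiskType) → RiskType → ℝ}
    {η : List (Φ × RiskType)} {θ θr : RiskType} {c : ℝ} {n : ℕ} (hU : ∀ y, U η θr y = c)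
    (hW : ∀ y θ', W ((E.signal y, θr) :: η) θ' = c * E.annuity n) :
    E.reportValue U W η θ θr = c * E.annuity (n + 1) := by
  have : ∀ y : Y, ∑ θ' : RiskType, E.trans θ θ' * W ((E.signal y, θr) :: η) θ'
      = c * E.annuity n := fun y => by
    rw [sum_riskType, hW, hW, ← add_mul, E.trans_l_add, one_mul]
  simp only [reportValue, hU, this, E.sum_p_mul_const, annuity]
  ring

lemma map_fst_highHistory (sig : List Φ) : (highHistory sig).map Prod.fst = sig := by
  simp [highHistory, Function.comp_def]

end LikelihoodRatios

/-! ### Signal likelihood ratios. -/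

section SignalRatios

variable [DecidableEq Φ] (E : Environment Y Φ)

/-- Likelihood ratio of a signal. -/
noncomputable def signalRatio (s : Φ) : ℝ := E.signalProb .l s / E.signalProb .h s

/-- Expected likelihood ratio of the signal of a low type. -/
noncomputable def meanSignalRatio : ℝ := ∑ y, E.p .l y * E.signalRatio (E.signal y)

lemma sum_signalProb_mul [Fintype Φ] (θ : RiskType) (f : Φ → ℝ) :
    ∑ s, E.signalProb θ s * f s = ∑ y, E.p θ y * f (E.signal y) := by
  rw [← Finset.sum_fiberwise (s := Finset.univ) (g := E.signal)]
  refine Finset.sum_congr rfl fun s _ => ?_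
  rw [signalProb, Finset.sum_mul]
  refine Finset.sum_congr rfl fun y hy => ?_
  rw [(Finset.mem_filter.1 hy).2]

variable {E}

lemma signalProb_h_pos (hph : ∀ y, 0 < E.p .h y) (s : Φ) : 0 < E.signalProb .h s := by
  obtain ⟨y, rfl⟩ := E.signal_surjective s
  exact Finset.sum_pos (fun y _ => hph y) ⟨y, by simp⟩

lemma signalRatio_pos (hph : ∀ y, 0 < E.p .h y) (hpl : ∀ s, 0 < E.signalProb .l s) (s : Φ) :
    0 < E.signalRatio s := div_pos (hpl s) (signalProb_h_pos hph s)

/-- Change of measure for functions of the signal. -/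
lemma sum_p_l_mul [Fintype Φ] (hph : ∀ y, 0 < E.p .h y) (f : Φ → ℝ) :
    ∑ y, E.p .l y * f (E.signal y)
      = ∑ y, E.p .h y * (E.signalRatio (E.signal y) * f (E.signal y)) := by
  rw [← E.sum_signalProb_mul, ← E.sum_signalProb_mul .h fun s => E.signalRatio s * f s]
  refine Finset.sum_congr rfl fun s _ => ?_
  rw [signalRatio, ← mul_assoc, mul_div_cancel₀ _ (signalProb_h_pos hph s).ne']

lemma sum_p_h_signalRatio [Fintype Φ] (hph : ∀ y, 0 < E.p .h y) :
    ∑ y, E.p .h y * E.signalRatio (E.signal y) = 1 := by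
  have := sum_p_l_mul hph fun _ => (1 : ℝ)
  simp only [mul_one, E.sum_p] at this
  exact this.symm

/-- The same variance identity, now only weak: the signal may be uninformative. -/
lemma one_le_meanSignalRatio [Fintype Φ] (hph : ∀ y, 0 < E.p .h y) : 1 ≤ E.meanSignalRatio := by
  have h1 : ∑ y, E.p .h y * (1 - E.signalRatio (E.signal y)) ^ 2 = E.meanSignalRatio - 1 := by
    have : ∀ y, E.p .h y * (1 - E.signalRatio (E.signal y)) ^ 2
        = E.p .h y - 2 * (E.p .h y * E.signalRatio (E.signal y))
          + E.p .h y * (E.signalRatio (E.signal y) * E.signalRatio (E.signal y)) := fun y => by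
      ring
    rw [meanSignalRatio, sum_p_l_mul hph]
    simp only [this, Finset.sum_add_distrib, Finset.sum_sub_distrib, ← Finset.mul_sum, E.sum_p,
      sum_p_h_signalRatio hph]
    ring
  have h2 : 0 ≤ ∑ y, E.p .h y * (1 - E.signalRatio (E.signal y)) ^ 2 :=
    Finset.sum_nonneg fun y _ => mul_nonneg (hph y).le (sq_nonneg _)
  linarith

end SignalRatios

/-! ### Gap coefficients and decay of the multiplier. -/

section Coefficients

variable [DecidableEq Φ] (E : Environment Y Φ)

/-- Utility gap between the types generated by one unit of the multiplier of the low type's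
incentive constraint, with `n` periods left. -/
noncomputable def gapCoeff : ℕ → ℝ
  | 0 => 0
  | n + 1 => (E.meanIncomeRatio - 1) + E.δ * E.annuity n * (E.meanSignalRatio - 1)
      + E.δ * E.persistence * gapCoeff n * E.decayRate (gapCoeff n / E.annuity n)
        * E.meanSignalRatio

/-- Gap coefficient per unit of annuity. -/
noncomputable def gapLevel (n : ℕ) : ℝ := E.gapCoeff n / E.annuity n

/-- Expected growth factor of the multiplier when `n` periods are left. -/
noncomputable def decay (n : ℕ) : ℝ := E.decayRate (E.gapLevel n)

lemma gapCoeff_succ (n : ℕ) : E.gapCoeff (n + 1) =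
    (E.meanIncomeRatio - 1) + E.δ * E.annuity n * (E.meanSignalRatio - 1)
      + E.δ * E.persistence * E.gapCoeff n * E.decay n * E.meanSignalRatio := rfl

lemma annuity_mul_gapLevel (n : ℕ) : E.annuity n * E.gapLevel n = E.gapCoeff n := by
  cases n with
  | zero => simp [annuity, gapCoeff]
  | succ n => exact mul_div_cancel₀ _ (E.annuity_succ_pos n).ne'

variable [Fintype Φ] {E}

lemma gapCoeff_succ_pos (hph : ∀ y, 0 < E.p .h y) (n : ℕ) : 0 < E.gapCoeff (n + 1) := by
  have h1 := one_lt_meanIncomeRatio hph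
  have h2 := one_le_meanSignalRatio hph
  have key : ∀ n, 0 ≤ E.gapCoeff n → 0 < E.gapCoeff (n + 1) := fun n hn => by
    have h3 := E.decayRate_pos (div_nonneg hn (E.annuity_nonneg n))
    have h4 : 0 ≤ E.δ * E.annuity n * (E.meanSignalRatio - 1) :=
      mul_nonneg (mul_nonneg E.δ_pos.le (E.annuity_nonneg n)) (by linarith)
    have h5 : 0 ≤ E.δ * E.persistence * E.gapCoeff n * E.decay n * E.meanSignalRatio :=
      mul_nonneg (mul_nonneg (mul_nonneg (mul_nonneg E.δ_pos.le E.persistence_pos.le) hn) h3.le)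
        (by linarith)
    rw [gapCoeff_succ]
    linarith
  induction n with
  | zero => exact key 0 le_rfl
  | succ n ih => exact key _ ih.le

lemma gapCoeff_nonneg (hph : ∀ y, 0 < E.p .h y) : ∀ n, 0 ≤ E.gapCoeff n
  | 0 => le_rfl
  | n + 1 => (gapCoeff_succ_pos hph n).le

lemma gapLevel_nonneg (hph : ∀ y, 0 < E.p .h y) (n : ℕ) : 0 ≤ E.gapLevel n :=
  div_nonneg (gapCoeff_nonneg hph n) (E.annuity_nonneg n)

lemma gapLevel_succ_pos (hph : ∀ y, 0 < E.p .h y) (n : ℕ) : 0 < E.gapLevel (n + 1) :=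
  div_pos (gapCoeff_succ_pos hph n) (E.annuity_succ_pos n)

lemma decay_pos (hph : ∀ y, 0 < E.p .h y) (n : ℕ) : 0 < E.decay n :=
  E.decayRate_pos (gapLevel_nonneg hph n)

/-- This form of the definition of the decay is the one that matches coefficients in the first-order
condition. -/
lemma decay_spec (hph : ∀ y, 0 < E.p .h y) (n : ℕ) :
    E.trans .h .h * (1 + E.trans .h .l * E.gapLevel n) * E.decay n = E.persistence :=
  mul_div_cancel₀ _ (mul_pos E.trans_hh_pos (add_pos_of_pos_of_nonneg one_pos
    (mul_nonneg (E.trans_nonneg _ _) (gapLevel_nonneg hph n)))).ne'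

/-- Persistence is at most `π_hh`, and the denominator exceeds `π_hh` as soon as `π_hl` and the gap
level are positive, that is, with at least one period left. -/
lemma decay_succ_lt_one (hhl : 0 < E.trans .h .l) (hph : ∀ y, 0 < E.p .h y) (n : ℕ) :
    E.decay (n + 1) < 1 := by
  have h1 := mul_pos hhl (gapLevel_succ_pos hph n)
  have h2 := E.trans_hh_pos
  refine (div_lt_one (mul_pos h2 (by linarith))).2 ?_
  have h3 := mul_pos h2 h1
  have h4 := E.trans_nonneg .l .h
  change E.trans .h .h - E.trans .l .h < _
  linarith

end Coefficients

/-! ### The candidate plan and its incentive compatibility. -/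

section Candidate

variable [DecidableEq Φ] (E : Environment Y Φ) (V : RiskType → ℝ)

/-- Multiplier of the low type's incentive constraint after high reports. -/
noncomputable def multiplier : List Φ → ℝ
  | [] => (V .h - V .l) / E.gapCoeff E.T
  | s :: sig => E.decay (E.T - (sig.length + 1)) * E.signalRatio s * multiplier sig

/-- Expected flow utility of the high type after high reports. -/
noncomputable def highLevel : List Φ → ℝ
  | [] => V .h / E.annuity E.T
  | s :: sig => highLevel sig + E.multiplier V sig * (1 - E.signalRatio s)
      + E.trans .h .l * E.gapLevel (E.T - (sig.length + 1)) * E.multiplier V (s :: sig)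

/-- Constant utility provided after a first low report. -/
noncomputable def lowLevel (sig : List Φ) : ℝ :=
  E.highLevel V sig - E.gapLevel (E.T - sig.length) * E.multiplier V sig

/-- The constant utility level to which the consumer is entitled once she has reported `l`. -/
noncomputable def settledLevel : List (Φ × RiskType) → Option ℝ
  | [] => none
  | (_, θ) :: η =>
    match settledLevel η, θ with
    | some c, _ => some c
    | none, .l => some (E.lowLevel V (η.map Prod.fst))
    | none, .h => none

/-- The optimal utility plan: full insurance at a constant level from the first low report on, and
utilities that are affine in the likelihood ratio of income before. -/
noncomputable def candidate : UtilityPlan Y Φ := fun η θ y =>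
  match E.settledLevel V η, θ with
  | some c, _ => c
  | none, .l => E.lowLevel V (η.map Prod.fst)
  | none, .h => E.highLevel V (η.map Prod.fst)
      + E.multiplier V (η.map Prod.fst) * (1 - E.incomeRatio y)

/-- Truthful continuation values in the candidate plan. -/
noncomputable def candidateValue (n : ℕ) (η : List (Φ × RiskType)) (θ : RiskType) : ℝ :=
  match E.settledLevel V η, θ with
  | some c, _ => c * E.annuity n
  | none, .l => E.highLevel V (η.map Prod.fst) * E.annuity n
      - E.gapCoeff n * E.multiplier V (η.map Prod.fst)
  | none, .h => E.highLevel V (η.map Prod.fst) * E.annuity n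

variable {E V}

lemma settledLevel_cons_of_some {η : List (Φ × RiskType)} {c : ℝ}
    (h : E.settledLevel V η = some c) (s : Φ) (θ : RiskType) :
    E.settledLevel V ((s, θ) :: η) = some c := by
  simp [settledLevel, h]

lemma settledLevel_cons_l {η : List (Φ × RiskType)} (h : E.settledLevel V η = none) (s : Φ) :
    E.settledLevel V ((s, .l) :: η) = some (E.lowLevel V (η.map Prod.fst)) := by
  simp [settledLevel, h]

lemma settledLevel_cons_h {η : List (Φ × RiskType)} (h : E.settledLevel V η = none) (s : Φ) :
    E.settledLevel V ((s, .h) :: η) = none := by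
  simp [settledLevel, h]

lemma settledLevel_highHistory (sig : List Φ) : E.settledLevel V (highHistory sig) = none := by
  induction sig with
  | nil => rfl
  | cons s sig ih => exact settledLevel_cons_h ih s

lemma candidate_highHistory_l (sig : List Φ) (y : Y) :
    E.candidate V (highHistory sig) .l y = E.lowLevel V sig := by
  simp [candidate, settledLevel_highHistory, map_fst_highHistory]

lemma candidate_highHistory_h (sig : List Φ) (y : Y) :
    E.candidate V (highHistory sig) .h y
      = E.highLevel V sig + E.multiplier V sig * (1 - E.incomeRatio y) := by
  simp [candidate, settledLevel_highHistory, map_fst_highHistory]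

lemma lowLevel_mul_annuity {n : ℕ} {sig : List Φ} (hn : n + sig.length = E.T) :
    E.lowLevel V sig * E.annuity n
      = E.highLevel V sig * E.annuity n - E.gapCoeff n * E.multiplier V sig := by
  rw [lowLevel, show E.T - sig.length = n by omega, ← E.annuity_mul_gapLevel]
  ring

lemma reportValue_candidate_settled {η : List (Φ × RiskType)} {c : ℝ}
    (h : E.settledLevel V η = some c) (n : ℕ) (θ θr : RiskType) :
    E.reportValue (E.candidate V) (E.candidateValue V n) η θ θr
      = E.candidateValue V (n + 1) η θ := by
  rw [reportValue_of_const (c := c) (n := n)]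
  · simp [candidateValue, h]
  · simp [candidate, h]
  · simp [candidateValue, settledLevel_cons_of_some h]

lemma reportValue_candidate_l {η : List (Φ × RiskType)} (h : E.settledLevel V η = none) (n : ℕ)
    (θ : RiskType) :
    E.reportValue (E.candidate V) (E.candidateValue V n) η θ .l
      = E.lowLevel V (η.map Prod.fst) * E.annuity (n + 1) := by
  rw [reportValue_of_const (n := n)]
  · simp [candidate, h]
  · simp [candidateValue, settledLevel_cons_l h]

variable [Fintype Φ]

/-- For the high type this is promise keeping: the `π_hl` term in `highLevel` offsets the expected
loss from turning low. For the low type it is indifference, which is what the recursion of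
`gapCoeff` encodes. -/
lemma reportValue_candidate_h (hph : ∀ y, 0 < E.p .h y) {η : List (Φ × RiskType)}
    (h : E.settledLevel V η = none) {n : ℕ} (hn : n + 1 + η.length = E.T) (θ : RiskType) :
    E.reportValue (E.candidate V) (E.candidateValue V n) η θ .h
      = E.candidateValue V (n + 1) η θ := by
  set sig := η.map Prod.fst with hsig
  have hT : E.T - (sig.length + 1) = n := by simp [hsig]; omega
  have hag := E.annuity_mul_gapLevel n
  have hll := E.trans_l_add .l
  have hlh := E.trans_l_add .h
  set L := E.highLevel V sig with hL
  set m := E.multiplier V sig with hm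
  have hU : ∀ y, E.candidate V η .h y = L + m * (1 - E.incomeRatio y) := fun y => by
    simp [candidate, h, L, m, hsig]
  have hWl : ∀ y, E.candidateValue V n ((E.signal y, .h) :: η) .l
      = E.highLevel V (E.signal y :: sig) * E.annuity n
        - E.gapCoeff n * E.multiplier V (E.signal y :: sig) := fun y => by
    simp [candidateValue, settledLevel_cons_h h, hsig]
  have hWh : ∀ y, E.candidateValue V n ((E.signal y, .h) :: η) .h
      = E.highLevel V (E.signal y :: sig) * E.annuity n := fun y => by
    simp [candidateValue, settledLevel_cons_h h, hsig]
  simp only [reportValue, sum_riskType, hU, hWl, hWh, highLevel, multiplier, hT,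
    ← hL, ← hm]
  cases θ
  · have h1 : ∀ y, E.p .l y * (L + m * (1 - E.incomeRatio y))
        = E.p .l y * (L + m) - m * (E.p .l y * E.incomeRatio y) := fun y => by ring
    have h2 : ∀ y : Y, E.p .l y *
        (E.trans .l .l * ((L + m * (1 - E.signalRatio (E.signal y)) + E.trans .h .l * E.gapLevel n *
              (E.decay n * E.signalRatio (E.signal y) * m)) * E.annuity n
            - E.gapCoeff n * (E.decay n * E.signalRatio (E.signal y) * m))
          + E.trans .l .h * ((L + m * (1 - E.signalRatio (E.signal y)) + E.trans .h .l *
              E.gapLevel n * (E.decay n * E.signalRatio (E.signal y) * m)) * E.annuity n))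
        = E.p .l y * ((L + m) * E.annuity n)
          - (m * E.annuity n + E.persistence * E.gapCoeff n * E.decay n * m)
            * (E.p .l y * E.signalRatio (E.signal y)) := fun y => by
      rw [← hag, show E.trans .l .h = 1 - E.trans .l .l by linarith, E.persistence_eq]
      ring
    simp only [h1, h2, Finset.sum_sub_distrib, ← Finset.mul_sum, E.sum_p_mul_const]
    have : E.candidateValue V (n + 1) η .l = L * E.annuity (n + 1) - E.gapCoeff (n + 1) * m := by
      simp [candidateValue, h, L, m, hsig]
    rw [this, gapCoeff_succ, annuity]
    change L + m - m * E.meanIncomeRatio + E.δ * ((L + m) * E.annuity n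
      - (m * E.annuity n + E.persistence * E.gapCoeff n * E.decay n * m) * E.meanSignalRatio) = _
    ring
  · have h1 : ∀ y, E.p .h y * (L + m * (1 - E.incomeRatio y))
        = E.p .h y * (L + m) - m * (E.p .h y * E.incomeRatio y) := fun y => by ring
    have h2 : ∀ y : Y, E.p .h y *
        (E.trans .h .l * ((L + m * (1 - E.signalRatio (E.signal y)) + E.trans .h .l * E.gapLevel n *
              (E.decay n * E.signalRatio (E.signal y) * m)) * E.annuity n
            - E.gapCoeff n * (E.decay n * E.signalRatio (E.signal y) * m))
          + E.trans .h .h * ((L + m * (1 - E.signalRatio (E.signal y)) + E.trans .h .l *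
              E.gapLevel n * (E.decay n * E.signalRatio (E.signal y) * m)) * E.annuity n))
        = E.p .h y * ((L + m) * E.annuity n)
          - (m * E.annuity n) * (E.p .h y * E.signalRatio (E.signal y)) := fun y => by
      rw [← hag, show E.trans .h .h = 1 - E.trans .h .l by linarith]
      ring
    simp only [h1, h2, Finset.sum_sub_distrib, ← Finset.mul_sum, E.sum_p_mul_const,
      sum_p_h_incomeRatio hph, sum_p_h_signalRatio hph]
    have : E.candidateValue V (n + 1) η .h = L * E.annuity (n + 1) := by
      simp [candidateValue, h, L, hsig]
    rw [this, annuity]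
    ring

lemma multiplier_pos (hph : ∀ y, 0 < E.p .h y) (hpl : ∀ s, 0 < E.signalProb .l s)
    (hV : V .l < V .h) (hT : 0 < E.T) (sig : List Φ) : 0 < E.multiplier V sig := by
  induction sig with
  | nil =>
    obtain ⟨n, hn⟩ := Nat.exists_eq_succ_of_ne_zero hT.ne'
    rw [multiplier, hn]
    exact div_pos (sub_pos.2 hV) (gapCoeff_succ_pos hph n)
  | cons s sig ih =>
    exact mul_pos (mul_pos (decay_pos hph _) (signalRatio_pos hph hpl s)) ih

lemma reportValue_candidate_self (hph : ∀ y, 0 < E.p .h y) {η : List (Φ × RiskType)} {n : ℕ}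
    (hn : n + 1 + η.length = E.T) (θ : RiskType) :
    E.reportValue (E.candidate V) (E.candidateValue V n) η θ θ
      = E.candidateValue V (n + 1) η θ := by
  rcases h : E.settledLevel V η with _ | c
  · cases θ
    · rw [reportValue_candidate_l h, lowLevel_mul_annuity (by simpa using hn)]
      simp [candidateValue, h]
    · exact reportValue_candidate_h hph h hn .h
  · exact reportValue_candidate_settled h n θ θ

/-- Only a high type reporting low before settlement can change her value, and she loses `gapCoeff
(n + 1)` times the multiplier. -/
lemma reportValue_candidate_le (hph : ∀ y, 0 < E.p .h y) (hpl : ∀ s, 0 < E.signalProb .l s)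
    (hV : V .l < V .h) {η : List (Φ × RiskType)} {n : ℕ}
    (hn : n + 1 + η.length = E.T) (θ θr : RiskType) :
    E.reportValue (E.candidate V) (E.candidateValue V n) η θ θr
      ≤ E.candidateValue V (n + 1) η θ := by
  rcases h : E.settledLevel V η with _ | c
  · cases θr
    · cases θ
      · exact (reportValue_candidate_self hph hn .l).le
      · rw [reportValue_candidate_l h, lowLevel_mul_annuity (by simpa using hn)]
        have h1 := mul_nonneg (gapCoeff_nonneg hph (n + 1))
          (multiplier_pos hph hpl hV (by omega) (η.map Prod.fst)).le
        simp only [candidateValue, h]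
        linarith
    · exact (reportValue_candidate_h hph h hn θ).le
  · exact (reportValue_candidate_settled h n θ θr).le

lemma truthValue_candidate (hph : ∀ y, 0 < E.p .h y) (n : ℕ) (η : List (Φ × RiskType))
    (hn : n + η.length = E.T) (θ : RiskType) :
    E.truthValue (E.candidate V) n η θ = E.candidateValue V n η θ := by
  induction n generalizing η θ with
  | zero =>
    rcases h : E.settledLevel V η with _ | c <;> cases θ <;>
      simp [truthValue, historySum, candidateValue, h, annuity, gapCoeff]
  | succ n ih =>
    rw [truthValue_succ, ← reportValue_candidate_self hph hn θ, reportValue, reportValue]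
    have : ∀ y θ', E.truthValue (E.candidate V) n ((E.signal y, θ) :: η) θ'
        = E.candidateValue V n ((E.signal y, θ) :: η) θ' := fun y θ' =>
      ih _ (by simp; omega) θ'
    simp only [this]

/-- One-shot deviation principle: backward induction bounds an arbitrary strategy, whatever was
misreported in the past. -/
lemma discountedSum_candidate_le (hph : ∀ y, 0 < E.p .h y) (hpl : ∀ s, 0 < E.signalProb .l s)
    (hV : V .l < V .h) (r : ReportingStrategy Y) (n : ℕ) (past : List (Y × RiskType))
    (hn : n + past.length = E.T) (θ : RiskType) :
    E.discountedSum (E.strategyFlow (E.candidate V) r) n past θ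
      ≤ E.candidateValue V n (E.observable (privateHistory r past)) θ := by
  induction n generalizing past θ with
  | zero =>
    rcases h : E.settledLevel V (E.observable (privateHistory r past)) with _ | c <;> cases θ <;>
      simp [discountedSum, candidateValue, h, annuity, gapCoeff]
  | succ n ih =>
    refine le_trans ?_ (reportValue_candidate_le hph hpl hV (by rw [length_observable]; exact hn)
      θ (r (privateHistory r past) θ))
    rw [discountedSum_strategyFlow_succ, reportValue]
    gcongr with y _ θ' _
    · exact E.δ_pos.le
    · exact E.p_nonneg _ _
    · exact E.trans_nonneg _ _
    · exact ih ((y, θ) :: past) (by simp; omega) θ'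

lemma truthValue_candidate_nil (hph : ∀ y, 0 < E.p .h y) (hT : 0 < E.T) (θ : RiskType) :
    E.truthValue (E.candidate V) E.T [] θ = V θ := by
  rw [truthValue_candidate hph _ _ rfl]
  obtain ⟨n, hn⟩ := Nat.exists_eq_succ_of_ne_zero hT.ne'
  have h1 := (E.annuity_succ_pos n).ne'
  have h2 := (gapCoeff_succ_pos hph n).ne'
  cases θ
  · simp only [candidateValue, settledLevel, List.map_nil, highLevel, multiplier, hn]
    rw [div_mul_cancel₀ _ h1, mul_div_cancel₀ _ h2]
    ring
  · simp only [candidateValue, settledLevel, List.map_nil, highLevel, hn]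
    rw [div_mul_cancel₀ _ h1]

/-- The candidate plan is incentive compatible. -/
lemma strategyValue_candidate_le (hph : ∀ y, 0 < E.p .h y) (hpl : ∀ s, 0 < E.signalProb .l s)
    (hinit : ∀ θ, 0 < E.init θ) (hV : V .l < V .h) (r : ReportingStrategy Y) :
    E.strategyValue (E.candidate V) r ≤ E.strategyValue (E.candidate V) (truthful Y) := by
  rw [strategyValue_truthful, strategyValue]
  gcongr with θ _
  · exact (hinit θ).le
  · rw [truthValue_candidate hph _ _ rfl]
    exact discountedSum_candidate_le hph hpl hV r _ [] rfl θ

/-- In the candidate plan the low type's incentive constraint binds after high reports. -/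
lemma reportValue_candidate_binding (hph : ∀ y, 0 < E.p .h y) (n : ℕ) (sig : List Φ)
    (hn : n + 1 + sig.length = E.T) :
    E.reportValue (E.candidate V) (E.truthValue (E.candidate V) n) (highHistory sig) .l .h
      = E.truthValue (E.candidate V) (n + 1) (highHistory sig) .l := by
  have hlen : (highHistory sig).length = sig.length := by simp [highHistory]
  rw [truthValue_candidate hph _ _ (by rw [hlen]; exact hn),
    ← reportValue_candidate_h hph (settledLevel_highHistory sig) (by rw [hlen]; exact hn) .l,
    reportValue, reportValue]
  have : ∀ y θ', E.truthValue (E.candidate V) n ((E.signal y, .h) :: highHistory sig) θ'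
      = E.candidateValue V n ((E.signal y, .h) :: highHistory sig) θ' := fun y θ' =>
    truthValue_candidate hph _ _ (by simp [hlen]; omega) θ'
  simp only [this]

end Candidate

end Environment

end DynamicInsurance

namespace DynamicInsurance

namespace Environment

variable {Y : Finset ℝ≥0} {Φ : Type*}

/-! ### The first-order condition at the candidate. -/

section Optimality

variable [DecidableEq Φ] {E : Environment Y Φ} {V : RiskType → ℝ}

/-- Once settled, the candidate is a constant and factors out of the inner product. -/
lemma historySum_inner_settled (X : UtilityPlan Y Φ) (n : ℕ) {η : List (Φ × RiskType)} {c : ℝ}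
    (h : E.settledLevel V η = some c) (θ : RiskType) :
    E.historySum (E.planInner (E.candidate V) X) n η θ = c * E.truthValue X n η θ := by
  induction n generalizing η θ with
  | zero => simp [historySum, truthValue]
  | succ n ih =>
    have h1 : E.planInner (E.candidate V) X η θ = c * ∑ y, E.p θ y * X η θ y := by
      rw [planInner, Finset.mul_sum]
      refine Finset.sum_congr rfl fun y _ => ?_
      simp only [candidate, h]
      ring
    have h2 : ∑ y : Y, E.p θ y * ∑ θ' : RiskType, E.trans θ θ' *
          E.historySum (E.planInner (E.candidate V) X) n ((E.signal y, θ) :: η) θ'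
        = c * ∑ y : Y, E.p θ y * ∑ θ' : RiskType, E.trans θ θ' *
          E.truthValue X n ((E.signal y, θ) :: η) θ' := by
      rw [Finset.mul_sum]
      refine Finset.sum_congr rfl fun y _ => ?_
      simp only [ih (settledLevel_cons_of_some h (E.signal y) θ), sum_riskType]
      ring
    rw [historySum, h1, h2, truthValue_succ, reportValue]
    ring

lemma historySum_inner_l (X : UtilityPlan Y Φ) (n : ℕ) (sig : List Φ) :
    E.historySum (E.planInner (E.candidate V) X) n (highHistory sig) .l
      = E.lowLevel V sig * E.truthValue X n (highHistory sig) .l := by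
  cases n with
  | zero => simp [historySum, truthValue]
  | succ n =>
    have h1 : E.planInner (E.candidate V) X (highHistory sig) .l
        = E.lowLevel V sig * ∑ y, E.p .l y * X (highHistory sig) .l y := by
      rw [planInner, Finset.mul_sum]
      refine Finset.sum_congr rfl fun y _ => ?_
      rw [candidate_highHistory_l]
      ring
    have h0 : ∀ s, E.settledLevel V ((s, .l) :: highHistory sig) = some (E.lowLevel V sig) :=
      fun s => by rw [settledLevel_cons_l (settledLevel_highHistory sig), map_fst_highHistory]
    have h2 : ∑ y : Y, E.p .l y * ∑ θ' : RiskType, E.trans .l θ' *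
          E.historySum (E.planInner (E.candidate V) X) n ((E.signal y, .l) :: highHistory sig) θ'
        = E.lowLevel V sig * ∑ y : Y, E.p .l y * ∑ θ' : RiskType, E.trans .l θ' *
          E.truthValue X n ((E.signal y, .l) :: highHistory sig) θ' := by
      rw [Finset.mul_sum]
      refine Finset.sum_congr rfl fun y _ => ?_
      simp only [historySum_inner_settled X n (h0 (E.signal y)), sum_riskType]
      ring
    rw [historySum, h1, h2, truthValue_succ, reportValue]
    ring

variable [Fintype Φ]

/-- First-order condition: at a history of high reports, the inner product of the candidate with a
direction respecting the low type's incentive constraints is bounded below in terms of the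
continuation values of that direction. -/
lemma le_historySum_inner (hph : ∀ y, 0 < E.p .h y) (hpl : ∀ s, 0 < E.signalProb .l s)
    (hV : V .l < V .h) {X : UtilityPlan Y Φ}
    (hX : ∀ (n : ℕ) (sig : List Φ), n + 1 + sig.length = E.T →
      E.reportValue X (E.truthValue X n) (highHistory sig) .l .h
        ≤ E.truthValue X (n + 1) (highHistory sig) .l)
    (n : ℕ) (sig : List Φ) (hn : n + sig.length = E.T) :
    (E.highLevel V sig + E.multiplier V sig) * E.truthValue X n (highHistory sig) .h
        - E.multiplier V sig * E.truthValue X n (highHistory sig) .l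
      ≤ E.historySum (E.planInner (E.candidate V) X) n (highHistory sig) .h := by
  induction n generalizing sig with
  | zero => simp [historySum, truthValue]
  | succ n ih =>
    have hm := (multiplier_pos hph hpl hV (by omega) sig).le
    have hT : E.T - (sig.length + 1) = n := by omega
    set L := E.highLevel V sig with hL
    set m := E.multiplier V sig with hm'
    -- Since `p_h (L + m (1 - p_l/p_h)) = (L + m) p_h - m p_l`, the weight `-m` falls on the low
    -- type's value from reporting high. The incentive constraint replaces it by her truthful value.
    have hnode := mul_le_mul_of_nonneg_left (hX n sig hn) hm
    have hflow : E.planInner (E.candidate V) X (highHistory sig) .h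
        = (L + m) * ∑ y, E.p .h y * X (highHistory sig) .h y
          - m * ∑ y, E.p .l y * X (highHistory sig) .h y := by
      rw [planInner, Finset.mul_sum, Finset.mul_sum, ← Finset.sum_sub_distrib]
      refine Finset.sum_congr rfl fun y _ => ?_
      rw [candidate_highHistory_h, p_l_eq hph]
      ring
    have hcont : (L + m) * (∑ y : Y, E.p .h y * ∑ θ' : RiskType, E.trans .h θ' *
            E.truthValue X n ((E.signal y, .h) :: highHistory sig) θ')
          - m * (∑ y : Y, E.p .l y * ∑ θ' : RiskType, E.trans .l θ' *
            E.truthValue X n ((E.signal y, .h) :: highHistory sig) θ')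
        ≤ ∑ y : Y, E.p .h y * ∑ θ' : RiskType, E.trans .h θ' *
            E.historySum (E.planInner (E.candidate V) X) n
              ((E.signal y, .h) :: highHistory sig) θ' := by
      -- Continuation values depend on income only through the signal. Moving everything to `p_h`
      -- reduces the inequality to one for each signal.
      rw [sum_p_l_mul hph fun s => ∑ θ' : RiskType, E.trans .l θ' *
        E.truthValue X n ((s, .h) :: highHistory sig) θ', Finset.mul_sum, Finset.mul_sum,
        ← Finset.sum_sub_distrib]
      refine Finset.sum_le_sum fun y _ => ?_
      have h1 := mul_le_mul_of_nonneg_left (ih (E.signal y :: sig) (by simp; omega))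
        E.trans_hh_pos.le
      have h2 := historySum_inner_l (E := E) (V := V) X n (E.signal y :: sig)
      have h3 : E.lowLevel V (E.signal y :: sig) = E.highLevel V (E.signal y :: sig)
          - E.gapLevel n * E.multiplier V (E.signal y :: sig) := by
        rw [lowLevel, List.length_cons, hT]
      rw [h3] at h2
      simp only [highLevel, multiplier, hT, ← hL, ← hm'] at h1 h2
      change _ ≤ E.p .h y * ∑ θ' : RiskType, E.trans .h θ' *
        E.historySum (E.planInner (E.candidate V) X) n (highHistory (E.signal y :: sig)) θ'
      change (L + m) * (E.p .h y * ∑ θ' : RiskType, E.trans .h θ' *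
          E.truthValue X n (highHistory (E.signal y :: sig)) θ')
        - m * (E.p .h y * (E.signalRatio (E.signal y) * ∑ θ' : RiskType, E.trans .l θ' *
          E.truthValue X n (highHistory (E.signal y :: sig)) θ')) ≤ _
      simp only [sum_riskType]
      rw [h2]
      refine le_trans (le_of_eq ?_) (mul_le_mul_of_nonneg_left
        (add_le_add_right h1 _) (hph y).le)
      -- The coefficients of the next high and low values must agree on both sides. These two
      -- equations are what determine the updates of `highLevel` and `multiplier`.
      have hd := decay_spec hph n
      have hll := E.persistence_eq
      have hlh : E.trans .l .h = E.trans .h .h - E.persistence := by unfold persistence; ring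
      have hhh := E.trans_l_add .h
      rw [show E.trans .l .l = E.persistence + E.trans .h .l by linarith, hlh, ← hd,
        show E.trans .h .l = 1 - E.trans .h .h by linarith]
      ring
    have hδ := mul_le_mul_of_nonneg_left hcont E.δ_pos.le
    rw [historySum, hflow]
    simp only [truthValue_succ _ _ _ _ RiskType.h]
    rw [reportValue] at hnode ⊢
    linarith

/-- At the root both values of the direction are zero because promises are kept, so the lower bound
is zero. -/
lemma total_inner_nonneg (hinit : ∀ θ, 0 < E.init θ) (hph : ∀ y, 0 < E.p .h y)
    (hpl : ∀ s, 0 < E.signalProb .l s) (hV : V .l < V .h) {X : UtilityPlan Y Φ}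
    (hX : ∀ (n : ℕ) (sig : List Φ), n + 1 + sig.length = E.T →
      E.reportValue X (E.truthValue X n) (highHistory sig) .l .h
        ≤ E.truthValue X (n + 1) (highHistory sig) .l)
    (hX0 : ∀ θ, E.truthValue X E.T [] θ = 0) :
    0 ≤ E.total (E.planInner (E.candidate V) X) := by
  have h1 := le_historySum_inner hph hpl hV hX E.T [] rfl
  have h2 := historySum_inner_l (E := E) (V := V) X E.T []
  simp only [highHistory, List.map_nil, hX0, mul_zero, sub_zero] at h1 h2
  rw [total, sum_riskType, h2, mul_zero, zero_add]
  exact mul_nonneg (hinit _).le h1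

end Optimality

/-! ### Mechanisms, utility plans and the quadratic cost. -/

section Mechanisms

variable (E : Environment Y Φ)

/-- The utility plan of a mechanism when utility is `2√c`. -/
noncomputable def utilityPlan (M : Mechanism Y Φ) : UtilityPlan Y Φ :=
  fun η θ y => sqrtUtility (M η θ y)

/-- The mechanism that provides the absolute values of the utilities in `U`. -/
noncomputable def mechanismOf (U : UtilityPlan Y Φ) : Mechanism Y Φ :=
  fun η θ y => Real.toNNReal ((U η θ y / 2) ^ 2)

lemma utilityPlan_mechanismOf (U : UtilityPlan Y Φ) (η : List (Φ × RiskType)) (θ : RiskType)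
    (y : Y) : utilityPlan (mechanismOf U) η θ y = |U η θ y| := by
  rw [utilityPlan, sqrtUtility, mechanismOf, Real.coe_toNNReal _ (sq_nonneg _), Real.sqrt_sq_eq_abs,
    abs_div, abs_two]
  ring

lemma exAnteValue_eq (M : Mechanism Y Φ) (r : ReportingStrategy Y) :
    E.exAnteValue sqrtUtility M r = E.strategyValue (utilityPlan M) r := rfl

lemma initialValue_eq (M : Mechanism Y Φ) (θ : RiskType) :
    E.initialValue sqrtUtility M (truthful Y) θ = E.truthValue (utilityPlan M) E.T [] θ :=
  E.discountedSum_eq_truthValue (utilityPlan M) (truthful Y) 0 (fun _ _ _ => rfl) _ [] le_rfl θ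

lemma profit_eq (M : Mechanism Y Φ) :
    E.profit M = E.total (fun _ θ => ∑ y : Y, E.p θ y * ((y : ℝ≥0) : ℝ))
      - 1 / 4 * E.total (E.planInner (utilityPlan M) (utilityPlan M)) := by
  have h1 : E.profit M = E.total fun η θ => E.flowProfit (M η θ) θ := by
    unfold profit total
    refine Finset.sum_congr rfl fun θ _ => ?_
    congr 1
    exact E.discountedSum_signals (fun η θ => E.flowProfit (M η θ) θ) E.T [] θ
  have h2 : (fun η θ => E.flowProfit (M η θ) θ)
      = fun η θ => 1 * (∑ y : Y, E.p θ y * ((y : ℝ≥0) : ℝ))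
        + -(1 / 4) * E.planInner (utilityPlan M) (utilityPlan M) η θ := by
    funext η θ
    rw [flowProfit, planInner, Finset.mul_sum, Finset.mul_sum, ← Finset.sum_add_distrib]
    refine Finset.sum_congr rfl fun y _ => ?_
    have : utilityPlan M η θ y * utilityPlan M η θ y = 4 * (M η θ y : ℝ) := by
      rw [utilityPlan, sqrtUtility]
      linear_combination 4 * Real.mul_self_sqrt (M η θ y).coe_nonneg
    rw [this]
    ring
  rw [h1, h2, E.total_linear 1 (-(1 / 4))
    (fun _ θ => ∑ y : Y, E.p θ y * ((y : ℝ≥0) : ℝ)) (E.planInner _ _)]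
  ring

/-- Histories of length at least `T` never enter, so nonnegativity of a plan is needed only on
shorter ones. -/
lemma discountedSum_strategyFlow_congr {U U' : UtilityPlan Y Φ}
    (h : ∀ η θ y, η.length < E.T → U η θ y = U' η θ y) (r : ReportingStrategy Y) (n : ℕ)
    (past : List (Y × RiskType)) (hn : n + past.length = E.T) (θ : RiskType) :
    E.discountedSum (E.strategyFlow U r) n past θ
      = E.discountedSum (E.strategyFlow U' r) n past θ := by
  induction n generalizing past θ with
  | zero => rfl
  | succ n ih =>
    have h1 : ∀ y θ', E.discountedSum (E.strategyFlow U r) n ((y, θ) :: past) θ'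
        = E.discountedSum (E.strategyFlow U' r) n ((y, θ) :: past) θ' := fun y θ' =>
      ih _ (by simp; omega) θ'
    have h2 : ∀ θr y, U (E.observable (privateHistory r past)) θr y
        = U' (E.observable (privateHistory r past)) θr y := fun θr y =>
      h _ _ _ (by rw [length_observable]; omega)
    simp only [discountedSum_strategyFlow_succ, h1, h2]

variable {E}

lemma strategyValue_congr {U U' : UtilityPlan Y Φ}
    (h : ∀ η θ y, η.length < E.T → U η θ y = U' η θ y) (r : ReportingStrategy Y) :
    E.strategyValue U r = E.strategyValue U' r := by
  simp only [strategyValue, E.discountedSum_strategyFlow_congr h r E.T [] rfl]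

lemma truthValue_congr {U U' : UtilityPlan Y Φ}
    (h : ∀ η θ y, η.length < E.T → U η θ y = U' η θ y) (θ : RiskType) :
    E.truthValue U E.T [] θ = E.truthValue U' E.T [] θ := by
  have := E.discountedSum_strategyFlow_congr h (truthful Y) E.T [] rfl θ
  rw [E.discountedSum_eq_truthValue U (truthful Y) 0 (fun _ _ _ => rfl) _ _ le_rfl,
    E.discountedSum_eq_truthValue U' (truthful Y) 0 (fun _ _ _ => rfl) _ _ le_rfl] at this
  exact this

/-- An interior utility plan stays nonnegative after a small move in any direction. -/
lemma exists_mix_nonneg [Finite Φ] {U : UtilityPlan Y Φ}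
    (hU : ∀ η θ y, η.length < E.T → 0 < U η θ y) (U' : UtilityPlan Y Φ) :
    ∃ ε ∈ Set.Ioo (0 : ℝ) 1, ∀ η θ y, η.length < E.T →
      0 ≤ (1 - ε) * U η θ y + ε * U' η θ y := by
  have hfin : {η : List (Φ × RiskType) | η.length < E.T}.Finite := List.finite_length_lt _ _
  have h1 : ∀ᶠ ε in nhdsWithin (0 : ℝ) (Set.Ioi 0), ∀ η ∈ {η : List (Φ × RiskType) |
      η.length < E.T}, ∀ θ y, 0 ≤ (1 - ε) * U η θ y + ε * U' η θ y := by
    rw [Filter.eventually_all_finite hfin]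
    intro η hη
    rw [Filter.eventually_all]
    intro θ
    rw [Filter.eventually_all]
    intro y
    have hc : Continuous fun ε : ℝ => (1 - ε) * U η θ y + ε * U' η θ y := by fun_prop
    have h0 : (0 : ℝ) < (1 - 0) * U η θ y + 0 * U' η θ y := by simpa using hU η θ y hη
    exact Filter.Eventually.mono
      (nhdsWithin_le_nhds (hc.continuousAt.eventually (lt_mem_nhds h0))) fun _ h => le_of_lt h
  obtain ⟨ε, h, hε⟩ := (h1.and (Ioo_mem_nhdsGT one_pos)).exists
  exact ⟨ε, hε, fun η θ y hη => h η hη θ y⟩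

lemma total_inner_add (U X : UtilityPlan Y Φ) (b : ℝ) :
    E.total (E.planInner (fun η θ y => U η θ y + b * X η θ y) fun η θ y => U η θ y + b * X η θ y)
      = E.total (E.planInner U U) + 2 * b * E.total (E.planInner U X)
        + b ^ 2 * E.total (E.planInner X X) := by
  have h : E.planInner (fun η θ y => U η θ y + b * X η θ y) (fun η θ y => U η θ y + b * X η θ y)
      = fun η θ => 1 * (1 * E.planInner U U η θ + 2 * b * E.planInner U X η θ)
        + b ^ 2 * E.planInner X X η θ := by
    funext η θ
    simp only [planInner, Finset.mul_sum, ← Finset.sum_add_distrib]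
    exact Finset.sum_congr rfl fun y _ => by ring
  rw [h, E.total_linear 1 (b ^ 2)
    (fun η θ => 1 * E.planInner U U η θ + 2 * b * E.planInner U X η θ), total_linear]
  ring

/-! ### Identification of the optimum after high reports. -/

variable [Fintype Φ] [DecidableEq Φ]

/-- An interior optimal mechanism provides the utilities of the candidate plan after high reports,
wherever they matter. -/
theorem utilityPlan_eq_candidate (hinit : ∀ θ, 0 < E.init θ) (hhl : 0 < E.trans .h .l)
    (hph : ∀ y, 0 < E.p .h y) (hpl : ∀ s, 0 < E.signalProb .l s) {V : RiskType → ℝ}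
    (hV : V .l < V .h) {M : Mechanism Y Φ} (hM : E.IsOptimal sqrtUtility V M)
    (hint : E.Interior M) {sig : List Φ} (hsig : sig.length < E.T) (θ : RiskType) (y : Y)
    (hy : 0 < E.p θ y) :
    utilityPlan M (highHistory sig) θ y = E.candidate V (highHistory sig) θ y := by
  obtain ⟨⟨hIC, hVM⟩, hopt⟩ := hM
  have hT : 0 < E.T := by omega
  set U := utilityPlan M with hUdef
  set C := E.candidate V with hC
  set X : UtilityPlan Y Φ := fun η θ y => 1 * U η θ y + -1 * C η θ y with hXdef
  have hICU : ∀ r, E.strategyValue U r ≤ E.strategyValue U (truthful Y) := hIC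
  have hICC := fun r => strategyValue_candidate_le hph hpl hinit hV r
  have hU0 : ∀ θ, E.truthValue U E.T [] θ = V θ := fun θ => by
    rw [← hVM θ, E.initialValue_eq]
  have hC0 : ∀ θ, E.truthValue C E.T [] θ = V θ := truthValue_candidate_nil hph hT
  -- The low type's constraints hold weakly for `U` and with equality for `C`, so their difference
  -- is an admissible direction.
  have hP : 0 ≤ E.total (E.planInner C X) := by
    refine total_inner_nonneg hinit hph hpl hV (fun n sig hn => ?_) fun θ => ?_
    · have h1 := reportValue_le_truthValue hinit hhl hph hICU n sig hn
      have h2 := reportValue_candidate_binding (V := V) hph n sig hn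
      have h3 : E.truthValue X n
          = fun η θ => 1 * E.truthValue U n η θ + -1 * E.truthValue C n η θ := by
        funext η θ
        exact E.truthValue_linear _ _ _ _ _ _ _
      rw [h3, hXdef, E.reportValue_linear, E.truthValue_linear, h2]
      linarith
    · rw [hXdef, E.truthValue_linear, hU0, hC0]
      ring
  have hXX : ∀ η θ, 0 ≤ E.planInner X X η θ := fun η θ =>
    Finset.sum_nonneg fun y _ => mul_nonneg (E.p_nonneg _ _) (mul_self_nonneg _)
  have hN : 0 ≤ E.total (E.planInner X X) :=
    Finset.sum_nonneg fun θ _ => mul_nonneg (hinit θ).le (historySum_nonneg hXX _ _ _)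
  have hUpos : ∀ η θ y, η.length < E.T → 0 < U η θ y := fun η θ y hη =>
    mul_pos two_pos (Real.sqrt_pos.2 (hint η θ y hη))
  -- `C` is not known to be nonnegative and need not come from a mechanism. Interiority of `U` makes
  -- a small step towards it legitimate.
  obtain ⟨ε, ⟨hε0, hε1⟩, hε⟩ := exists_mix_nonneg hUpos C
  set W : UtilityPlan Y Φ := fun η θ y => (1 - ε) * U η θ y + ε * C η θ y with hW
  have hWcongr : ∀ η θ y, η.length < E.T → utilityPlan (mechanismOf W) η θ y = W η θ y :=
    fun η θ y hη => by rw [utilityPlan_mechanismOf, abs_of_nonneg (hε η θ y hη)]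
  have hfeas : E.Feasible sqrtUtility V (mechanismOf W) := by
    refine ⟨fun r => ?_, fun θ => ?_⟩
    · rw [exAnteValue_eq, exAnteValue_eq, strategyValue_congr hWcongr, strategyValue_congr hWcongr,
        hW, E.strategyValue_linear, E.strategyValue_linear]
      exact add_le_add (mul_le_mul_of_nonneg_left (hICU r) (by linarith))
        (mul_le_mul_of_nonneg_left (hICC r) hε0.le)
    · rw [initialValue_eq, truthValue_congr hWcongr, hW, E.truthValue_linear, hU0, hC0]
      ring
  have hcost := hopt _ hfeas
  -- Absolute values disappear in squares, so here no bound on the history length is needed.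
  have hWW : E.planInner (utilityPlan (mechanismOf W)) (utilityPlan (mechanismOf W))
      = E.planInner W W := by
    funext η θ
    simp only [planInner, utilityPlan_mechanismOf, abs_mul_abs_self]
  have hU' : U = fun η θ y => C η θ y + 1 * X η θ y := by
    funext η θ y
    simp only [hXdef]
    ring
  have hW' : W = fun η θ y => C η θ y + (1 - ε) * X η θ y := by
    funext η θ y
    simp only [hXdef, hW]
    ring
  rw [profit_eq, profit_eq, hWW, hW', ← hUdef] at hcost
  rw [total_inner_add] at hcost
  have hUU : E.total (E.planInner U U) = E.total (E.planInner C C)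
      + 2 * 1 * E.total (E.planInner C X) + 1 ^ 2 * E.total (E.planInner X X) := by
    rw [← total_inner_add, ← hU']
  rw [hUU] at hcost
  -- The cost comparison reads `2ε⟨C, X⟩ + (1 - (1 - ε)²)⟨X, X⟩ ≤ 0`, and its first term is
  -- nonnegative.
  have hle : ε * (2 - ε) * E.total (E.planInner X X) ≤ 0 := by
    have := mul_nonneg hε0.le hP
    linarith
  have hN0 : E.total (E.planInner X X) = 0 :=
    le_antisymm (nonpos_of_mul_nonpos_right hle (mul_pos hε0 (by linarith))) hN
  obtain ⟨n, hn⟩ : ∃ n, n + 1 + sig.length = E.T := ⟨E.T - sig.length - 1, by omega⟩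
  have hz := eq_zero_of_total_eq_zero hinit hhl hph hXX hN0 hn θ
  have hz' := (Finset.sum_eq_zero_iff_of_nonneg fun y _ =>
    mul_nonneg (E.p_nonneg _ _) (mul_self_nonneg _)).1 hz y (Finset.mem_univ _)
  have hx := mul_self_eq_zero.1 ((mul_eq_zero.1 hz').resolve_left hy.ne')
  simp only [hXdef] at hx
  linarith

lemma flowUtility_eq_candidate (hinit : ∀ θ, 0 < E.init θ) (hhl : 0 < E.trans .h .l)
    (hph : ∀ y, 0 < E.p .h y) (hpl : ∀ s, 0 < E.signalProb .l s) {V : RiskType → ℝ}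
    (hV : V .l < V .h) {M : Mechanism Y Φ} (hM : E.IsOptimal sqrtUtility V M)
    (hint : E.Interior M) {sig : List Φ} (hsig : sig.length < E.T) :
    E.highFlow sqrtUtility M sig = E.highLevel V sig ∧
    E.distortion sqrtUtility M sig = E.multiplier V sig * (E.meanIncomeRatio - 1) ∧
    E.lowFlow sqrtUtility M sig = E.lowLevel V sig := by
  have key := fun θ y => utilityPlan_eq_candidate hinit hhl hph hpl hV hM hint hsig θ y
  have hh : ∀ y, sqrtUtility (M (highHistory sig) .h y)
      = E.highLevel V sig + E.multiplier V sig * (1 - E.incomeRatio y) := fun y => by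
    rw [← candidate_highHistory_h]
    exact key .h y (hph y)
  have h1 : E.highFlow sqrtUtility M sig = E.highLevel V sig := by
    have : ∀ y, E.p .h y * (E.highLevel V sig + E.multiplier V sig * (1 - E.incomeRatio y))
        = E.p .h y * (E.highLevel V sig + E.multiplier V sig)
          - E.multiplier V sig * (E.p .h y * E.incomeRatio y) := fun y => by ring
    simp only [highFlow, flowUtility, hh, this, Finset.sum_sub_distrib, ← Finset.mul_sum,
      E.sum_p_mul_const, sum_p_h_incomeRatio hph]
    ring
  refine ⟨h1, ?_, ?_⟩
  · have : ∀ y, E.p .l y * (E.highLevel V sig + E.multiplier V sig * (1 - E.incomeRatio y))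
        = E.p .l y * (E.highLevel V sig + E.multiplier V sig)
          - E.multiplier V sig * (E.p .l y * E.incomeRatio y) := fun y => by ring
    rw [distortion, h1]
    simp only [flowUtility, hh, this, Finset.sum_sub_distrib, ← Finset.mul_sum,
      E.sum_p_mul_const]
    rw [meanIncomeRatio]
    ring
  · rw [lowFlow, flowUtility, ← E.sum_p_mul_const .l (E.lowLevel V sig)]
    refine Finset.sum_congr rfl fun y _ => ?_
    -- The contract is not identified at incomes that are impossible for the low type, but these
    -- carry zero weight.
    rcases (E.p_nonneg .l y).eq_or_lt with h0 | h0
    · rw [← h0, zero_mul, zero_mul]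
    · rw [← candidate_highHistory_l (E := E) sig y]
      congr 1
      exact key .l y h0

lemma sum_signalProb_mul_affine (hph : ∀ y, 0 < E.p .h y) (a b : ℝ) :
    ∑ s, E.signalProb .h s * (a + b * E.signalRatio s) = a + b := by
  rw [E.sum_signalProb_mul .h fun s => a + b * E.signalRatio s]
  have : ∀ y, E.p .h y * (a + b * E.signalRatio (E.signal y))
      = E.p .h y * a + b * (E.p .h y * E.signalRatio (E.signal y)) := fun y => by ring
  simp only [this, Finset.sum_add_distrib, ← Finset.mul_sum, E.sum_p_mul_const,
    sum_p_h_signalRatio hph, mul_one]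

end Mechanisms

end Environment

end DynamicInsurance

/-! ### The comparison of consecutive periods. -/

theorem mainTheorem7 {Y : Finset ℝ≥0} {Φ : Type*} [Fintype Φ] [DecidableEq Φ]
    (E : DynamicInsurance.Environment Y Φ)
    (hinit : ∀ θ, 0 < E.init θ)
    (hhl : 0 < E.trans .h .l)
    (hph : ∀ y, 0 < E.p .h y)
    (hpl : ∀ s, 0 < E.signalProb .l s)
    (V : DynamicInsurance.RiskType → ℝ) (hV : V .l < V .h)
    (M : DynamicInsurance.Mechanism Y Φ)
    (hM : E.IsOptimal DynamicInsurance.sqrtUtility V M)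
    (hint : E.Interior M)
    (sig : List Φ) (hsig : sig.length + 1 < E.T) :
    (∑ s : Φ, E.signalProb .h s * E.distortion DynamicInsurance.sqrtUtility M (s :: sig)
        < E.distortion DynamicInsurance.sqrtUtility M sig) ∧
    (E.highFlow DynamicInsurance.sqrtUtility M sig
        < ∑ s : Φ, E.signalProb .h s * E.highFlow DynamicInsurance.sqrtUtility M (s :: sig)) ∧
    (∑ s : Φ, E.signalProb .h s * E.lowFlow DynamicInsurance.sqrtUtility M (s :: sig)
        < E.highFlow DynamicInsurance.sqrtUtility M sig) := by
  -- From the next period on at least one period remains; this makes the gap level positive and the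
  -- decay strictly below one.
  obtain ⟨n, hn⟩ : ∃ n, E.T - (sig.length + 1) = n + 1 := ⟨E.T - (sig.length + 2), by omega⟩
  have hsig' : sig.length < E.T := by omega
  obtain ⟨h1, h2, -⟩ :=
    DynamicInsurance.Environment.flowUtility_eq_candidate hinit hhl hph hpl hV hM hint hsig'
  have H := fun s => DynamicInsurance.Environment.flowUtility_eq_candidate (sig := s :: sig)
    hinit hhl hph hpl hV hM hint hsig
  have hm : 0 < E.multiplier V sig :=
    DynamicInsurance.Environment.multiplier_pos hph hpl hV (by omega) sig
  have hq := DynamicInsurance.Environment.gapLevel_succ_pos hph n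
  have hd := DynamicInsurance.Environment.decay_pos hph (n + 1)
  have hd1 := DynamicInsurance.Environment.decay_succ_lt_one hhl hph n
  have hR := DynamicInsurance.Environment.one_lt_meanIncomeRatio hph
  have hhh := E.trans_l_add .h
  have haff := DynamicInsurance.Environment.sum_signalProb_mul_affine (E := E) hph
  rw [h1, h2]
  simp only [(H _).1, (H _).2.1, (H _).2.2, DynamicInsurance.Environment.lowLevel,
    DynamicInsurance.Environment.highLevel, DynamicInsurance.Environment.multiplier,
    List.length_cons, hn]
  set m := E.multiplier V sig
  set L := E.highLevel V sig
  set q := E.gapLevel (n + 1)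
  set d := E.decay (n + 1)
  have hqdm : 0 < q * d * m := mul_pos (mul_pos hq hd) hm
  refine ⟨?_, ?_, ?_⟩
  -- Each next-period quantity is affine in the signal ratio, whose mean under `p_h` is one.
  · have : ∀ s, d * E.signalRatio s * m * (E.meanIncomeRatio - 1)
        = 0 + d * m * (E.meanIncomeRatio - 1) * E.signalRatio s := fun s => by ring
    simp only [this]
    rw [haff, zero_add]
    exact mul_lt_mul_of_pos_right (mul_lt_of_lt_one_left hm hd1) (by linarith)
  · have : ∀ s, L + m * (1 - E.signalRatio s) + E.trans .h .l * q * (d * E.signalRatio s * m)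
        = L + m + (E.trans .h .l * (q * d * m) - m) * E.signalRatio s := fun s => by ring
    simp only [this, haff]
    have := mul_pos hhl hqdm
    linarith
  · have : ∀ s, L + m * (1 - E.signalRatio s) + E.trans .h .l * q * (d * E.signalRatio s * m)
          - q * (d * E.signalRatio s * m)
        = L + m + (-(E.trans .h .h * (q * d * m)) - m) * E.signalRatio s := fun s => by
      rw [← eq_sub_iff_add_eq] at hhh
      rw [hhh]
      ring
    simp only [this, haff]
    have := mul_pos E.trans_hh_pos hqdm
    linarith
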